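/- An operational-probabilistic theory (OPT) consists of the following. It has systems, closed under a symmetric parallel composition $\otimes$ with a trivial system $\mathrm I$. It has transformations, closed under sequential and parallel composition; states of $\mathrm A$ are transformations $\mathrm I\to\mathrm A$, effects on $\mathrm A$ are transformations $\mathrm A\to\mathrm I$, and scalars $\mathrm I\to\mathrm I$ are associated with probabilities, composing multiplicatively. It has tests, i.e. finite collections of transformations; every transformation occurs in a test, the probabilities of a test made of scalars sum to $1$, and identities, swaps and the structural isomorphisms of $\otimes$ are channels (one-outcome tests). Tests are closed under parallel composition, under sequential composition in which the second test may depend on the outcome of the first, and under coarse-graining along partitions; coins of every bias $p\in[0,1]$ can be tossed. Transformations with the same probabilities in all closed circuits (including those with ancillas) are identified, and so span real vector spaces, in which sums of transformations are taken. For every system the states span a finite-dimensional vector space and form a closed set. Write $(a|\rho)$ for the probability of the effect $a$ on the state $\rho$. A state $\rho$ is normalised if $\sup_a(a|\rho)=1$, and an effect $a$ is normalised if $\sup_\rho(a|\rho)=1$. A transformation $\mathcal C$ is pure if, whenever it is the sum of a nonempty set $\{\mathcal D_j\}$ of members of a test, $\mathcal D_j=p_j\mathcal C$ for a probability distribution $\{p_j\}$.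 A sharp theory with purification is an OPT satisfying: (Causality) the probability of a transformation is independent of the test performed on its output; (Purity Preservation) sequential and parallel compositions of pure transformations are pure; (Pure Sharpness) every system has a pure effect that occurs with probability $1$ on some state; (Purification) every normalised state of a system $\mathrm A$ is the marginal of a normalised pure state of some $\mathrm A\otimes\mathrm B$, and any two such purifications with the same $\mathrm B$ differ by a reversible channel on $\mathrm B$. In a sharp theory with purification, for each normalised pure state $\alpha$ let $\alpha^\dagger$ denote the unique normalised pure effect with $(\alpha^\dagger|\alpha)=1$. A pure maximal set of $\mathrm A$ is a family $\{\alpha_i\}_{i=1}^d$ of normalised pure states that is perfectly distinguishable (there is an observation-test $\{a_i\}_{i=1}^d$ with $(a_i|\alpha_j)=\delta_{ij}$) and such that no further state $\rho_0$ can be added keeping perfect distinguishability. For $\mathsf I\subseteq\{1,\dots,d\}$ put $a_{\mathsf I}=\sum_{i\in\mathsf I}\alpha_i^\dagger$, and let $F_{\mathsf I}$ (resp. $F_{\mathsf I}^\perp$) be the set of normalised states $\rho$ of $\mathrm A$ with $(a_{\mathsf I}|\rho)=1$ (resp. $0$). An orthogonal projector on $F_{\mathsf I}$ is a transformation $P_{\mathsf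 I}:\mathrm A\to\mathrm A$ of the theory with $P_{\mathsf I}\rho=\rho$ for $\rho\in F_{\mathsf I}$ and $P_{\mathsf I}\rho=0$ for $\rho\in F_{\mathsf I}^\perp$. Write $\mathcal A\doteq\mathcal A'$ (equality on single system) if $\mathcal A\rho=\mathcal A'\rho$ for all states $\rho$ of the input system. **Proposition.** In a sharp theory with purification, fix a system $\mathrm A$, a pure maximal set $\{\alpha_i\}_{i=1}^d$ of $\mathrm A$ and subsets $\mathsf I,\mathsf J\subseteq\{1,\dots,d\}$. For any orthogonal projectors $P_{\mathsf I},P_{\mathsf J},P_{\mathsf I\cap\mathsf J}$ on $F_{\mathsf I},F_{\mathsf J},F_{\mathsf I\cap\mathsf J}$, $$P_{\mathsf I}P_{\mathsf J}\doteq P_{\mathsf I\cap\mathsf J}.$$ In particular, $P_{\mathsf I}^2\doteq P_{\mathsf I}$, and $P_{\mathsf I}P_{\mathsf J}\doteq 0$ if $\mathsf I\cap\mathsf J=\varnothing$. -/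

import Mathlib

open CategoryTheory MonoidalCategory

universe v u

/-- Raw data of an operational-probabilistic theory on a symmetric monoidal category.
Objects are systems, morphisms `A ⟶ B` are the transformations from `A` to `B`, `⊗` is parallel
composition and `𝟙_ Sys` is the trivial system.  So `𝟙_ Sys ⟶ A` is the set of states of `A`,
`A ⟶ 𝟙_ Sys` the set of effects on `A`, and scalars `𝟙_ Sys ⟶ 𝟙_ Sys` are associated with
probabilities by `prob`.  `IsTest C` says that the finite collection of transformations `C` is
one of the tests of the theory. -/
structure OPTData (Sys : Type u) [Category.{v} Sys] [MonoidalCategory Sys]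
    [SymmetricCategory Sys] where
  prob : (𝟙_ Sys ⟶ 𝟙_ Sys) → ℝ
  IsTest : ∀ {A B : Sys} {X : Type} [Finite X], (X → (A ⟶ B)) → Prop

namespace OPTData

variable {Sys : Type u} [Category.{v} Sys] [MonoidalCategory Sys] [SymmetricCategory Sys]

/-- `(a|ρ)`: the probability of the circuit made of the state `ρ` followed by the effect `a`. -/
def pair (T : OPTData Sys) {A : Sys} (a : A ⟶ 𝟙_ Sys) (ρ : 𝟙_ Sys ⟶ A) : ℝ :=
  T.prob (ρ ≫ a)

/-- A state as a real vector: the list of its probabilities on all effects. -/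
def stVec (T : OPTData Sys) {A : Sys} (ρ : 𝟙_ Sys ⟶ A) : (A ⟶ 𝟙_ Sys) → ℝ :=
  fun a => T.pair a ρ

/-- A transformation as a real vector: the list of the probabilities of all closed circuits
`(E| f ⊗ id_S |ρ)`, with an arbitrary ancillary system `S`.  Sums and real multiples of
transformations are taken in this vector space. -/
def vec (T : OPTData Sys) {A B : Sys} (f : A ⟶ B) :
    ∀ S : Sys, (𝟙_ Sys ⟶ A ⊗ S) → (B ⊗ S ⟶ 𝟙_ Sys) → ℝ :=
  fun S ρ E => T.pair E (ρ ≫ f ▷ S)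

/-- A channel (deterministic transformation): the only outcome of a one-outcome test. -/
def IsChannel (T : OPTData Sys) {A B : Sys} (f : A ⟶ B) : Prop :=
  T.IsTest (fun _ : Unit => f)

end OPTData

/-- An operational-probabilistic theory with finite systems and closed state spaces. -/
structure OPT (Sys : Type u) [Category.{v} Sys] [MonoidalCategory Sys]
    [SymmetricCategory Sys] extends OPTData Sys where
  prob_nonneg : ∀ p, 0 ≤ prob p
  prob_comp : ∀ p q, prob (p ≫ q) = prob p * prob q
  /-- the probabilities of the outcomes of a closed experiment add up to one -/
  prob_sum : ∀ {X : Type} [Fintype X] (p : X → (𝟙_ Sys ⟶ 𝟙_ Sys)), IsTest p →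
    ∑ x, prob (p x) = 1
  /-- transformations with the same probabilities in all closed circuits are equal -/
  separation : ∀ {A B : Sys} (f g : A ⟶ B), toOPTData.vec f = toOPTData.vec g → f = g
  /-- every transformation occurs in some test -/
  exists_test : ∀ {A B : Sys} (f : A ⟶ B), ∃ (X : Type) (_ : Finite X) (C : X → (A ⟶ B)) (x : X),
    IsTest C ∧ C x = f
  channel_id : ∀ A : Sys, toOPTData.IsChannel (𝟙 A)
  channel_associator_hom : ∀ A B C : Sys, toOPTData.IsChannel (α_ A B C).hom
  channel_associator_inv : ∀ A B C : Sys, toOPTData.IsChannel (α_ A B C).inv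
  channel_leftUnitor_hom : ∀ A : Sys, toOPTData.IsChannel (λ_ A).hom
  channel_leftUnitor_inv : ∀ A : Sys, toOPTData.IsChannel (λ_ A).inv
  channel_rightUnitor_hom : ∀ A : Sys, toOPTData.IsChannel (ρ_ A).hom
  channel_rightUnitor_inv : ∀ A : Sys, toOPTData.IsChannel (ρ_ A).inv
  channel_swap : ∀ A B : Sys, toOPTData.IsChannel (β_ A B).hom
  /-- sequential composition of tests; the second test may be chosen according to the outcome
  of the first one -/
  test_seq : ∀ {A B C : Sys} {X : Type} [Finite X] {Y : X → Type} [∀ x, Finite (Y x)]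
    (D : X → (A ⟶ B)) (E : ∀ x, Y x → (B ⟶ C)), IsTest D → (∀ x, IsTest (E x)) →
    IsTest (fun p : (x : X) × Y x => D p.1 ≫ E p.1 p.2)
  /-- parallel composition of tests -/
  test_par : ∀ {A B C D : Sys} {X Y : Type} [Finite X] [Finite Y]
    (E : X → (A ⟶ B)) (F : Y → (C ⟶ D)), IsTest E → IsTest F →
    IsTest (fun p : X × Y => E p.1 ⊗ₘ F p.2)
  /-- coarse-graining: the outcomes of a test can be joined along a partition -/
  test_coarse : ∀ {A B : Sys} {X Y : Type} [Finite X] [Fintype Y] [DecidableEq X]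
    (D : Y → (A ⟶ B)) (π : Y → X), IsTest D → Function.Surjective π →
    ∃ C : X → (A ⟶ B), IsTest C ∧
      ∀ x, toOPTData.vec (C x) = ∑ y with π y = x, toOPTData.vec (D y)
  /-- coins of every bias can be tossed -/
  test_coin : ∀ p : ℝ, 0 ≤ p → p ≤ 1 →
    ∃ c : Bool → (𝟙_ Sys ⟶ 𝟙_ Sys), IsTest c ∧ prob (c true) = p
  /-- the vector space spanned by the states of a system is finite-dimensional -/
  finite_dim : ∀ A : Sys, FiniteDimensional ℝ
    (Submodule.span ℝ (Set.range (toOPTData.stVec : (𝟙_ Sys ⟶ A) → (A ⟶ 𝟙_ Sys) → ℝ)))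
  /-- the set of states of a system is closed -/
  closed_states : ∀ A : Sys,
    IsClosed (Set.range (toOPTData.stVec : (𝟙_ Sys ⟶ A) → (A ⟶ 𝟙_ Sys) → ℝ))

namespace OPT

variable {Sys : Type u} [Category.{v} Sys] [MonoidalCategory Sys] [SymmetricCategory Sys]

/-- Normalised state: `‖ρ‖ = sup_a (a|ρ) = 1`. -/
def IsNormState (T : OPT Sys) {A : Sys} (ρ : 𝟙_ Sys ⟶ A) : Prop :=
  (⨆ a : A ⟶ 𝟙_ Sys, T.pair a ρ) = 1

/-- Normalised effect: `‖a‖ = sup_ρ (a|ρ) = 1`. -/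
def IsNormEffect (T : OPT Sys) {A : Sys} (a : A ⟶ 𝟙_ Sys) : Prop :=
  (⨆ ρ : 𝟙_ Sys ⟶ A, T.pair a ρ) = 1

/-- Pure transformation: whenever it is obtained by joining a (nonempty) set `s` of outcomes of
a test `D`, the `D y` with `y ∈ s` are multiples of it, by a probability distribution on `s`. -/
def IsPure (T : OPT Sys) {A B : Sys} (f : A ⟶ B) : Prop :=
  ∀ (Y : Type) [Finite Y] (D : Y → (A ⟶ B)) (s : Finset Y), T.IsTest D → s.Nonempty →
    T.vec f = ∑ y ∈ s, T.vec (D y) →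
    ∃ p : Y → ℝ, (∀ y ∈ s, 0 ≤ p y) ∧ ∑ y ∈ s, p y = 1 ∧ ∀ y ∈ s, T.vec (D y) = p y • T.vec f

/-- Reversible channel on a system. -/
def IsReversible (T : OPT Sys) {A : Sys} (U : A ⟶ A) : Prop :=
  T.IsChannel U ∧ ∃ V : A ⟶ A, T.IsChannel V ∧ U ≫ V = 𝟙 A ∧ V ≫ U = 𝟙 A

/-- `ρ` is the marginal on `A` of the state `Ψ` of `A ⊗ B` (a deterministic effect, unique in a
causal theory, is applied on `B`). -/
def IsMarginal (T : OPT Sys) {A B : Sys} (Ψ : 𝟙_ Sys ⟶ A ⊗ B) (ρ : 𝟙_ Sys ⟶ A) : Prop :=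
  ∃ e : B ⟶ 𝟙_ Sys, T.IsChannel e ∧ Ψ ≫ A ◁ e ≫ (ρ_ A).hom = ρ

/-- `Ψ` is a purification of `ρ` with purifying system `B`. -/
def IsPurification (T : OPT Sys) {A B : Sys} (Ψ : 𝟙_ Sys ⟶ A ⊗ B) (ρ : 𝟙_ Sys ⟶ A) : Prop :=
  T.IsNormState Ψ ∧ T.IsPure Ψ ∧ T.IsMarginal Ψ ρ

/-- Causality: the probability of a preparation does not depend on the test that is performed
on its output. -/
def Causality (T : OPT Sys) : Prop :=
  ∀ (A : Sys) (ρ : 𝟙_ Sys ⟶ A) (X Y : Type) [Fintype X] [Fintype Y]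
    (a : X → (A ⟶ 𝟙_ Sys)) (b : Y → (A ⟶ 𝟙_ Sys)), T.IsTest a → T.IsTest b →
    ∑ x, T.pair (a x) ρ = ∑ y, T.pair (b y) ρ

/-- Purity Preservation: sequential and parallel compositions of pure transformations are pure. -/
def PurityPreservation (T : OPT Sys) : Prop :=
  (∀ {A B C : Sys} (f : A ⟶ B) (g : B ⟶ C), T.IsPure f → T.IsPure g → T.IsPure (f ≫ g)) ∧
  (∀ {A B C D : Sys} (f : A ⟶ B) (g : C ⟶ D), T.IsPure f → T.IsPure g → T.IsPure (f ⊗ₘ g))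

/-- Pure Sharpness: every system has a pure effect occurring with unit probability on some
state. -/
def PureSharpness (T : OPT Sys) : Prop :=
  ∀ A : Sys, ∃ a : A ⟶ 𝟙_ Sys, T.IsPure a ∧ ∃ ρ : 𝟙_ Sys ⟶ A, T.pair a ρ = 1

/-- Purification: every normalised state has a purification, and two purifications of it with
the same purifying system differ by a reversible channel on the purifying system. -/
def Purification (T : OPT Sys) : Prop :=
  (∀ (A : Sys) (ρ : 𝟙_ Sys ⟶ A), T.IsNormState ρ →
    ∃ (B : Sys) (Ψ : 𝟙_ Sys ⟶ A ⊗ B), T.IsPurification Ψ ρ) ∧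
  (∀ (A B : Sys) (ρ : 𝟙_ Sys ⟶ A) (Ψ Ψ' : 𝟙_ Sys ⟶ A ⊗ B), T.IsNormState ρ →
    T.IsPurification Ψ ρ → T.IsPurification Ψ' ρ →
    ∃ U : B ⟶ B, T.IsReversible U ∧ Ψ' = Ψ ≫ A ◁ U)

/-- Sharp theories with purification. -/
structure IsSharpWithPurification (T : OPT Sys) : Prop where
  causality : T.Causality
  purityPreservation : T.PurityPreservation
  pureSharpness : T.PureSharpness
  purification : T.Purification

/-- Perfectly distinguishable states. -/
def PerfectlyDistinguishable (T : OPT Sys) {A : Sys} {X : Type} [Finite X]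
    (ρ : X → (𝟙_ Sys ⟶ A)) : Prop :=
  ∃ a : X → (A ⟶ 𝟙_ Sys), T.IsTest a ∧
    (∀ i, T.pair (a i) (ρ i) = 1) ∧ ∀ i j, i ≠ j → T.pair (a i) (ρ j) = 0

/-- Pure maximal set: perfectly distinguishable normalised pure states, such that no further
state can be added without losing perfect distinguishability. -/
def IsPureMaximal (T : OPT Sys) {A : Sys} {d : ℕ} (α : Fin d → (𝟙_ Sys ⟶ A)) : Prop :=
  (∀ i, T.IsNormState (α i) ∧ T.IsPure (α i)) ∧ T.PerfectlyDistinguishable α ∧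
  ¬ ∃ ρ₀ : 𝟙_ Sys ⟶ A, T.PerfectlyDistinguishable (fun o : Option (Fin d) => o.elim ρ₀ α)

open Classical in
/-- The dagger `α†` of a normalised pure state `α`: the normalised pure effect with
`(α†|α) = 1` (there is exactly one in a sharp theory with purification), here as a functional on
states. -/
noncomputable def dagger (T : OPT Sys) {A : Sys} (α : 𝟙_ Sys ⟶ A) : (𝟙_ Sys ⟶ A) → ℝ :=
  if h : ∃ a : A ⟶ 𝟙_ Sys, T.IsNormEffect a ∧ T.IsPure a ∧ T.pair a α = 1 then
    fun ρ => T.pair h.choose ρ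
  else 0

/-- The effect `a_I = ∑_{i ∈ I} α_i†`, as a functional on states. -/
noncomputable def faceEffect (T : OPT Sys) {A : Sys} {d : ℕ} (α : Fin d → (𝟙_ Sys ⟶ A))
    (I : Finset (Fin d)) : (𝟙_ Sys ⟶ A) → ℝ :=
  ∑ i ∈ I, T.dagger (α i)

/-- The face `F_I` of normalised states on which `a_I` has probability one. -/
def face (T : OPT Sys) {A : Sys} {d : ℕ} (α : Fin d → (𝟙_ Sys ⟶ A)) (I : Finset (Fin d)) :
    Set (𝟙_ Sys ⟶ A) :=
  {ρ | T.IsNormState ρ ∧ T.faceEffect α I ρ = 1}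

/-- The orthogonal face `F_I^⊥` of normalised states on which `a_I` has probability zero. -/
def orthFace (T : OPT Sys) {A : Sys} {d : ℕ} (α : Fin d → (𝟙_ Sys ⟶ A)) (I : Finset (Fin d)) :
    Set (𝟙_ Sys ⟶ A) :=
  {ρ | T.IsNormState ρ ∧ T.faceEffect α I ρ = 0}

/-- `P` is an orthogonal projector on the face `F_I`. -/
def IsProjector (T : OPT Sys) {A : Sys} {d : ℕ} (α : Fin d → (𝟙_ Sys ⟶ A))
    (I : Finset (Fin d)) (P : A ⟶ A) : Prop :=
  (∀ ρ ∈ T.face α I, ρ ≫ P = ρ) ∧ ∀ ρ ∈ T.orthFace α I, T.stVec (ρ ≫ P) = 0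

/-- Equality on single system: equal action on all states of `A`. -/
def EqOnSingle (_T : OPT Sys) {A B : Sys} (f g : A ⟶ B) : Prop :=
  ∀ ρ : 𝟙_ Sys ⟶ A, ρ ≫ f = ρ ≫ g

/-- Equality to zero on single system. -/
def ZeroOnSingle (T : OPT Sys) {A B : Sys} (f : A ⟶ B) : Prop :=
  ∀ ρ : 𝟙_ Sys ⟶ A, T.stVec (ρ ≫ f) = 0

end OPT

/-!
A projector `P` on the face `F_I` is determined on single systems by a transposition argument.  Let
`{α_i}` be a pure maximal set with daggers `a_i`.  One shows that `(a_i|α_j) = δ_ij`, that the `a_i`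
add up to the deterministic effect, and that the `α_i`, with equal weights, add up to a state `χ` in
which every state has a positive weight (`IsPureMaximal.resolution`).  Let `Φ`, a state of `A ⊗ B`,
purify `χ`.  For each `I` there is a transformation `Q` of `B` that fixes the states to which `Φ` is
steered by effects vanishing on the `α_i` with `i ∉ I`, and annihilates those to which it is steered
by effects vanishing on the `α_i` with `i ∈ I` (`exists_isDualProjector`).  As `P` annihilates the
`α_i` with `i ∉ I`, the state `P Φ` is steered only to states fixed by `Q`; as `Q` annihilates the
complementary ones, `Q Φ` is steered only to states fixed by `P`.  Hence, on product effects, `P Φ`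
coincides with `P Q Φ` and with `Q Φ` (`ActsAsProjector.condR_comp`).  Every state of `A` is
obtained from `Φ` by steering, so that `P` is unique up to `≐`; moreover `a_i P_J = a_i` for `i ∈ J`
and `a_i P_J = 0` for `i ∉ J`.  Thus `P_I P_J` acts as a projector on `F_{I ∩ J}`
(`ActsAsProjector.comp`), and the proposition follows by uniqueness.

The tools are the following.

* Identities are pure (`isPure_id`): an outcome of a decomposition of the identity multiplies the
  purification of each state by a number, hence also the state itself, and comparing a mixture with
  its components shows that the number does not depend on the state.
* Purifications with different purifying systems are related by pure transformations
  (`exists_pure_comp_purification`).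
* A compact convex set in finite dimension has a point fixed by all its symmetries
  (`exists_fixedPoint`); this gives a state invariant under reversible channels.  As these act
  transitively on pure states, all pure states have the same maximal weight in it, and the pure
  effects occurring with certainty on them all have that probability (`exists_common_weight`).
* Every decomposition of the marginal of a pure state is induced by an effect on the purifying
  system (`exists_steering`), provided that some system has two perfectly distinguishable states.
  From this follow the gentle measurement of any effect (`exists_gentle`), the uniqueness of the
  pure effect occurring with certainty on a given state (`pure_effect_unique`), and its minimality
  (`pure_effect_le`).

If `A` has two normalised states, then it has two perfectly distinguishable ones
(`exists_distinguishable`); a system with a single normalised state is treated directly.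
-/

namespace OPT

/-! ### Convex sets of real functions spanning a finite-dimensional space -/

/-- Functions in a finite-dimensional space are interpolated from their values at finitely many
points. -/
theorem exists_interpolation {ι : Type*} (V : Submodule ℝ (ι → ℝ)) [FiniteDimensional ℝ V] :
    ∃ (t : Finset ι) (φ : t → (ι → ℝ)), (∀ e, φ e ∈ V) ∧
      ∀ x ∈ V, x = ∑ e : t, x e • φ e := by
  classical
  let N : Finset ι → Submodule ℝ V := fun t => ⨅ e ∈ t, LinearMap.ker
    ((LinearMap.proj e : (ι → ℝ) →ₗ[ℝ] ℝ).comp V.subtype)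
  obtain ⟨_, ⟨t, rfl⟩, hmin⟩ := IsArtinian.set_has_minimal (R := ℝ) (Set.range N)
    ⟨_, Set.mem_range_self ∅⟩
  have hN : ∀ x : V, x ∈ N t → x = 0 := by
    intro x hx
    ext i
    have hle : N (insert i t) ≤ N t := by
      simp only [N, Finset.iInf_insert]
      exact inf_le_right
    have h1 : N (insert i t) = N t := by
      by_contra hne
      exact hmin _ ⟨_, rfl⟩ (lt_of_le_of_ne hle hne)
    rw [← h1] at hx
    simp only [N, Finset.iInf_insert, Submodule.mem_inf] at hx
    simpa using hx.1
  let r : V →ₗ[ℝ] (t → ℝ) := LinearMap.pi fun e =>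
    (LinearMap.proj (e : ι) : (ι → ℝ) →ₗ[ℝ] ℝ).comp V.subtype
  have hr : LinearMap.ker r = ⊥ := by
    rw [LinearMap.ker_eq_bot']
    intro x hx
    apply hN
    simp only [N, Submodule.mem_iInf, LinearMap.mem_ker]
    intro e he
    exact congrFun hx ⟨e, he⟩
  obtain ⟨L, hL⟩ := LinearMap.exists_leftInverse_of_injective r hr
  refine ⟨t, fun e => L (Pi.single e 1), fun e => (L _).2, fun x hx => ?_⟩
  have h1 : L (r ⟨x, hx⟩) = ⟨x, hx⟩ := LinearMap.congr_fun hL ⟨x, hx⟩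
  have h2 : r ⟨x, hx⟩ = ∑ e : t, x e • Pi.single e (1 : ℝ) := by
    ext e
    simp [r, Finset.sum_apply, Pi.single_apply]
  rw [h2, map_sum] at h1
  simp only [map_smul] at h1
  have h3 := congrArg Subtype.val h1
  simp only [AddSubmonoidClass.coe_finsetSum, SetLike.val_smul] at h3
  exact h3.symm

/-- A convex set of functions with values in `[0, 1]`, spanning a finite-dimensional space, has a
point in which all its points have a common positive weight. -/
theorem exists_orderUnit {ι : Type*} {S : Set (ι → ℝ)} (hS : Convex ℝ S) (hne : S.Nonempty)
    (hb : ∀ x ∈ S, ∀ e, x e ∈ Set.Icc (0 : ℝ) 1) (hfd : FiniteDimensional ℝ (Submodule.span ℝ S))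
    (u : ι) (hu : ∀ x ∈ S, x u = 1) :
    ∃ ω ∈ S, ∃ l : ℝ, 0 < l ∧ l < 1 ∧ ∀ x ∈ S, ∃ y ∈ S, ω = l • x + (1 - l) • y := by
  classical
  obtain ⟨t, φ, hφ, hint⟩ := exists_interpolation (Submodule.span ℝ S)
  obtain ⟨x₀, hx₀⟩ := hne
  have hex := fun e => Submodule.mem_span_iff_exists_finset_subset.1 (hφ e)
  choose m F hFS hsupp hm using hex
  let G : Finset (ι → ℝ) := insert x₀ (Finset.univ.biUnion F)
  have hGS : ∀ s ∈ G, s ∈ S := by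
    intro s hs
    simp only [G, Finset.mem_insert, Finset.mem_biUnion, Finset.mem_univ, true_and] at hs
    rcases hs with rfl | ⟨e, he⟩
    · exact hx₀
    · exact hFS e he
  have hφG : ∀ e, φ e = ∑ s ∈ G, m e s • s := by
    intro e
    rw [← hm e]
    refine Finset.sum_subset (fun s hs => ?_) fun s _ hs => ?_
    · simp only [G, Finset.mem_insert, Finset.mem_biUnion, Finset.mem_univ, true_and]
      exact Or.inr ⟨e, hs⟩
    · have : m e s = 0 := by
        by_contra h
        exact hs (hsupp e h)
      rw [this, zero_smul]
  let c : (ι → ℝ) → (ι → ℝ) → ℝ := fun x s => ∑ e : t, x e * m e s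
  let C : ℝ := ∑ s ∈ G, ∑ e : t, |m e s|
  have hC0 : 0 ≤ C := Finset.sum_nonneg fun s _ => Finset.sum_nonneg fun e _ => abs_nonneg _
  have hcC : ∀ x ∈ S, ∀ s ∈ G, c x s ≤ C := by
    intro x hx s hs
    refine le_trans (Finset.sum_le_sum fun e _ => ?_) (Finset.single_le_sum
      (f := fun s => ∑ e : t, |m e s|) (fun s _ => Finset.sum_nonneg fun e _ => abs_nonneg _) hs)
    have h1 := hb x hx e
    calc x e * m e s ≤ x e * |m e s| := mul_le_mul_of_nonneg_left (le_abs_self _) h1.1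
      _ ≤ 1 * |m e s| := mul_le_mul_of_nonneg_right h1.2 (abs_nonneg _)
      _ = |m e s| := one_mul _
  have hcx : ∀ x ∈ S, x = ∑ s ∈ G, c x s • s := by
    intro x hx
    have h1 := hint x (Submodule.subset_span hx)
    simp only [hφG, Finset.smul_sum, smul_smul] at h1
    rw [Finset.sum_comm] at h1
    simp only [← Finset.sum_smul] at h1
    exact h1
  have hsum : ∀ x ∈ S, ∑ s ∈ G, c x s = 1 := by
    intro x hx
    have h1 := congrFun (hcx x hx) u
    rw [hu x hx, Finset.sum_apply] at h1
    rw [h1]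
    refine Finset.sum_congr rfl fun s hs => ?_
    rw [Pi.smul_apply, hu s (hGS s hs), smul_eq_mul, mul_one]
  obtain ⟨N, hNdef⟩ : ∃ N : ℝ, (G.card : ℝ) = N := ⟨_, rfl⟩
  have hN1 : 1 ≤ N := by
    have : G.Nonempty := ⟨x₀, by simp [G]⟩
    rw [← hNdef]
    exact_mod_cast this.card_pos
  have hN : 0 < N := by linarith
  have hunif : ∑ _s ∈ G, (1 / N) = 1 := by
    rw [Finset.sum_const, nsmul_eq_mul, hNdef]; field_simp
  let l : ℝ := 1 / (N * (C + 2))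
  have hl0 : 0 < l := by positivity
  have hl1 : l < 1 := by
    rw [div_lt_one (by positivity)]; nlinarith
  have hlC : l * C ≤ 1 / N := by
    have : l * C = 1 / N * (C / (C + 2)) := by simp only [l]; field_simp
    rw [this]
    refine mul_le_of_le_one_right (by positivity) ?_
    rw [div_le_one (by positivity)]; linarith
  refine ⟨∑ s ∈ G, (1 / N) • s, hS.sum_mem (fun _ _ => by positivity) hunif hGS, l, hl0, hl1,
    fun x hx => ⟨∑ s ∈ G, ((1 / N - l * c x s) / (1 - l)) • s, hS.sum_mem (fun s hs => ?_) ?_ hGS,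
      ?_⟩⟩
  · refine div_nonneg ?_ (by linarith)
    have := mul_le_mul_of_nonneg_left (hcC x hx s hs) hl0.le
    linarith
  · rw [← Finset.sum_div, Finset.sum_sub_distrib, hunif, ← Finset.mul_sum, hsum x hx, mul_one,
      div_self (by linarith)]
  · have h1 : l • x = ∑ s ∈ G, (l * c x s) • s := by
      conv_lhs => rw [hcx x hx, Finset.smul_sum]
      simp only [smul_smul]
    rw [h1, Finset.smul_sum, ← Finset.sum_add_distrib]
    refine Finset.sum_congr rfl fun s _ => ?_
    rw [smul_smul, ← add_smul]
    congr 1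
    have : 1 - l ≠ 0 := by linarith
    field_simp
    ring

theorem exists_bound_of_mem_span {ι : Type*} {S : Set (ι → ℝ)}
    (hb : ∀ x ∈ S, ∀ e, x e ∈ Set.Icc (0 : ℝ) 1) {x : ι → ℝ} (hx : x ∈ Submodule.span ℝ S) :
    ∃ B : ℝ, ∀ e, |x e| ≤ B := by
  induction hx using Submodule.span_induction with
  | mem x hx => exact ⟨1, fun e => abs_le.2 ⟨by linarith [(hb x hx e).1], (hb x hx e).2⟩⟩
  | zero => exact ⟨0, fun e => by simp⟩
  | add x y _ _ hx hy =>
    obtain ⟨B, hB⟩ := hx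
    obtain ⟨C, hC⟩ := hy
    exact ⟨B + C, fun e => (abs_add_le _ _).trans (add_le_add (hB e) (hC e))⟩
  | smul c x _ hx =>
    obtain ⟨B, hB⟩ := hx
    refine ⟨|c| * B, fun e => ?_⟩
    rw [Pi.smul_apply, smul_eq_mul, abs_mul]
    exact mul_le_mul_of_nonneg_left (hB e) (abs_nonneg c)

/-- A group of symmetries of a compact convex set of functions spanning a finite-dimensional space
has a common fixed point.  The symmetries act by substitution.  The fixed point minimises the
largest Euclidean norm along the orbit, a strictly convex function invariant under the group. -/
theorem exists_fixedPoint {ι : Type*} {K V : Set (ι → ℝ)} (hK : IsCompact K) (hconv : Convex ℝ K)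
    (hne : K.Nonempty) (hKV : K ⊆ V) (hb : ∀ x ∈ V, ∀ e, x e ∈ Set.Icc (0 : ℝ) 1)
    (hfd : FiniteDimensional ℝ (Submodule.span ℝ V)) {G : Type*} [Nonempty G] (act : G → ι → ι)
    (hact : ∀ g, ∀ x ∈ K, x ∘ act g ∈ K) (hmul : ∀ g h, ∃ k, act k = act g ∘ act h)
    (hinv : ∀ g, ∃ h, ∀ e, act g (act h e) = e) :
    ∃ x ∈ K, ∀ g, x ∘ act g = x := by
  classical
  obtain ⟨t, φ, hφ, hint⟩ := exists_interpolation (Submodule.span ℝ V)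
  let f : G → (ι → ℝ) → ℝ := fun g x => ∑ e : t, (x (act g e)) ^ 2
  let F : (ι → ℝ) → ℝ := fun x => ⨆ g, f g x
  have hfb : ∀ x ∈ K, ∀ g, f g x ≤ t.card := by
    intro x hx g
    calc f g x ≤ ∑ _e : t, (1 : ℝ) := Finset.sum_le_sum fun e _ => by
          have := hb x (hKV hx) (act g e)
          exact pow_le_one₀ this.1 this.2
      _ = t.card := by simp
  have hbdd : ∀ x ∈ K, BddAbove (Set.range fun g => f g x) := fun x hx =>
    ⟨t.card, by rintro _ ⟨g, rfl⟩; exact hfb x hx g⟩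
  have hle : ∀ x ∈ K, ∀ g, f g x ≤ F x := fun x hx g => le_ciSup (hbdd x hx) g
  have hlsc : LowerSemicontinuousOn F K := by
    refine lowerSemicontinuousOn_ciSup hbdd fun g => ?_
    refine Continuous.lowerSemicontinuous ?_ |>.lowerSemicontinuousOn K
    simp only [f]
    fun_prop
  obtain ⟨x, hx, hmin⟩ := hlsc.exists_isMinOn hne hK
  refine ⟨x, hx, fun g => ?_⟩
  by_contra hxy
  set y := x ∘ act g with hy
  have hyK : y ∈ K := hact g x hx
  obtain ⟨e₀, he₀⟩ : ∃ e, y e ≠ x e := by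
    by_contra h
    push Not at h
    exact hxy (funext h)
  choose B hB using fun e => exists_bound_of_mem_span hb (hφ e)
  let D : ℝ := ∑ e, (B e) ^ 2
  have hD0 : 0 ≤ D := Finset.sum_nonneg fun e _ => sq_nonneg _
  let δ : ℝ := (x e₀ - y e₀) ^ 2 / (D + 1)
  have hδ : 0 < δ := div_pos (by have := sub_ne_zero.2 he₀.symm; positivity) (by positivity)
  have hest : ∀ h : G, δ ≤ ∑ e : t, (x (act h e) - y (act h e)) ^ 2 := by
    intro h
    obtain ⟨h', hh'⟩ := hinv h
    have hz : x ∘ act h - y ∘ act h ∈ Submodule.span ℝ V :=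
      Submodule.sub_mem _ (Submodule.subset_span (hKV (hact h x hx)))
        (Submodule.subset_span (hKV (hact h y hyK)))
    have h1 := congrFun (hint _ hz) (act h' e₀)
    simp only [Pi.sub_apply, Function.comp_apply, hh', Finset.sum_apply, Pi.smul_apply,
      smul_eq_mul] at h1
    rw [div_le_iff₀ (by positivity), h1]
    refine (Finset.sum_mul_sq_le_sq_mul_sq _ _ _).trans ?_
    refine mul_le_mul_of_nonneg_left ?_ (Finset.sum_nonneg fun _ _ => sq_nonneg _)
    have h2 : ∑ e, (φ e (act h' e₀)) ^ 2 ≤ D := Finset.sum_le_sum fun e _ => by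
      rw [← sq_abs]
      exact pow_le_pow_left₀ (abs_nonneg _) (hB e _) 2
    linarith
  let z : ι → ℝ := (1 / 2 : ℝ) • x + (1 / 2 : ℝ) • y
  have hzK : z ∈ K := hconv hx hyK (by norm_num) (by norm_num) (by norm_num)
  have hFy : ∀ h, f h y ≤ F x := by
    intro h
    obtain ⟨k, hk⟩ := hmul g h
    have : f h y = f k x := by simp [f, hy, hk]
    rw [this]
    exact hle x hx k
  have hFz : F z ≤ F x - δ / 4 := by
    refine ciSup_le fun h => ?_
    have h1 : f h z = f h x / 2 + f h y / 2 -
        (∑ e : t, (x (act h e) - y (act h e)) ^ 2) / 4 := by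
      simp only [f, z, Finset.sum_div, ← Finset.sum_add_distrib, ← Finset.sum_sub_distrib]
      refine Finset.sum_congr rfl fun e _ => ?_
      simp only [Pi.add_apply, Pi.smul_apply, smul_eq_mul]
      ring
    rw [h1]
    linarith [hest h, hFy h, hle x hx h]
  have := hmin hzK
  simp only [Set.mem_ofPred_eq] at this
  linarith

variable {Sys : Type u} [Category.{v} Sys] [MonoidalCategory Sys] [SymmetricCategory Sys]

/-! ### Closed circuits, discarding and conditional tests -/

theorem pair_nonneg (T : OPT Sys) {A : Sys} (a : A ⟶ 𝟙_ Sys) (ρ : 𝟙_ Sys ⟶ A) :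
    0 ≤ T.pair a ρ := T.prob_nonneg _

theorem prob_channel (T : OPT Sys) {p : 𝟙_ Sys ⟶ 𝟙_ Sys} (hp : T.IsChannel p) :
    T.prob p = 1 := by
  simpa using T.prob_sum (fun _ : Unit => p) hp

theorem prob_id (T : OPT Sys) : T.prob (𝟙 (𝟙_ Sys)) = 1 := T.prob_channel (T.channel_id _)

theorem pair_comp (T : OPT Sys) {A B : Sys} (f : A ⟶ B) (ρ : 𝟙_ Sys ⟶ A) (e : B ⟶ 𝟙_ Sys) :
    T.pair e (ρ ≫ f) = T.pair (f ≫ e) ρ := by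
  simp [OPTData.pair]

theorem pair_scalar (T : OPT Sys) {A : Sys} (c : 𝟙_ Sys ⟶ 𝟙_ Sys) (ρ : 𝟙_ Sys ⟶ A)
    (e : A ⟶ 𝟙_ Sys) : T.pair e (c ≫ ρ) = T.prob c * T.pair e ρ := by
  simp [OPTData.pair, T.prob_comp]

/-- A closed circuit containing a state without further input tests it by an effect on its
output alone. -/
theorem vec_state (T : OPT Sys) {A : Sys} (f : 𝟙_ Sys ⟶ A) (S : Sys) (φ : 𝟙_ Sys ⟶ 𝟙_ Sys ⊗ S)
    (E : A ⊗ S ⟶ 𝟙_ Sys) :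
    T.vec f S φ E = T.pair ((ρ_ A).inv ≫ A ◁ (φ ≫ (λ_ S).hom) ≫ E) f := by
  have h : f ≫ (ρ_ A).inv ≫ A ◁ (φ ≫ (λ_ S).hom) ≫ E = φ ≫ f ▷ S ≫ E := by
    rw [rightUnitor_inv_naturality_assoc, ← whisker_exchange_assoc, id_whiskerLeft]
    simp [← unitors_inv_equal]
  simp only [OPTData.vec, OPTData.pair, h, Category.assoc]

/-- A closed circuit containing an effect tests it on a state of its input alone. -/
theorem vec_effect (T : OPT Sys) {A : Sys} (a : A ⟶ 𝟙_ Sys) (S : Sys) (φ : 𝟙_ Sys ⟶ A ⊗ S)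
    (E : 𝟙_ Sys ⊗ S ⟶ 𝟙_ Sys) :
    T.vec a S φ E = T.pair a (φ ≫ A ◁ ((λ_ S).inv ≫ E) ≫ (ρ_ A).hom) := by
  have h : (φ ≫ A ◁ ((λ_ S).inv ≫ E) ≫ (ρ_ A).hom) ≫ a = φ ≫ a ▷ S ≫ E := by
    simp only [Category.assoc]
    rw [← rightUnitor_naturality, whisker_exchange_assoc, id_whiskerLeft]
    simp only [Category.assoc, ← unitors_equal, Iso.inv_hom_id, Category.comp_id,
      Iso.hom_inv_id_assoc]
  simp only [OPTData.vec, OPTData.pair, h, Category.assoc]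

/-- A circuit without ancilla is a circuit with trivial ancilla. -/
theorem pair_comp_eq_vec (T : OPT Sys) {A B : Sys} (f : A ⟶ B) (ρ : 𝟙_ Sys ⟶ A)
    (e : B ⟶ 𝟙_ Sys) :
    T.pair e (ρ ≫ f) = T.vec f (𝟙_ Sys) (ρ ≫ (ρ_ A).inv) ((ρ_ B).hom ≫ e) := by
  simp [OPTData.vec, OPTData.pair]

theorem pair_comp_of_vec_eq_sum {T : OPT Sys} {A B : Sys} {Y : Type} {f : A ⟶ B} {D : Y → (A ⟶ B)}
    {s : Finset Y} (h : T.vec f = ∑ y ∈ s, T.vec (D y)) (ρ : 𝟙_ Sys ⟶ A) (e : B ⟶ 𝟙_ Sys) :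
    T.pair e (ρ ≫ f) = ∑ y ∈ s, T.pair e (ρ ≫ D y) := by
  simp [pair_comp_eq_vec, h, Finset.sum_apply]

theorem pair_of_vec_eq_sum {T : OPT Sys} {A : Sys} {Y : Type} {f : 𝟙_ Sys ⟶ A}
    {D : Y → (𝟙_ Sys ⟶ A)} {s : Finset Y} (h : T.vec f = ∑ y ∈ s, T.vec (D y))
    (e : A ⟶ 𝟙_ Sys) : T.pair e f = ∑ y ∈ s, T.pair e (D y) := by
  simpa using pair_comp_of_vec_eq_sum h (𝟙 _) e

theorem state_ext (T : OPT Sys) {A : Sys} {ρ ρ' : 𝟙_ Sys ⟶ A}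
    (h : ∀ a, T.pair a ρ = T.pair a ρ') : ρ = ρ' := by
  apply T.separation
  funext S φ E
  rw [vec_state, vec_state, h]

theorem effect_ext (T : OPT Sys) {A : Sys} {a a' : A ⟶ 𝟙_ Sys}
    (h : ∀ ρ, T.pair a ρ = T.pair a' ρ) : a = a' := by
  apply T.separation
  funext S φ E
  rw [vec_effect, vec_effect, h]

theorem stVec_injective (T : OPT Sys) {A : Sys} :
    Function.Injective (T.stVec : (𝟙_ Sys ⟶ A) → (A ⟶ 𝟙_ Sys) → ℝ) :=
  fun _ _ h => T.state_ext fun a => congrFun h a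

theorem scalar_eq_id (T : OPT Sys) {c : 𝟙_ Sys ⟶ 𝟙_ Sys} (hc : T.prob c = 1) : c = 𝟙 _ := by
  apply T.state_ext
  intro a
  have h := T.pair_scalar c (𝟙 _) a
  rwa [Category.comp_id, hc, one_mul] at h

theorem test_reindex (T : OPT Sys) {A B : Sys} {X Y : Type} [Finite X] [Finite Y]
    (D : Y → (A ⟶ B)) (hD : T.IsTest D) (π : X ≃ Y) : T.IsTest (fun x => D (π x)) := by
  classical
  have := Fintype.ofFinite Y
  obtain ⟨C, hC, h⟩ := T.test_coarse D π.symm hD π.symm.surjective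
  convert hC using 2 with x
  apply T.separation
  rw [h]
  have : (Finset.univ.filter fun y => π.symm y = x) = {π x} := by
    ext y; simp [Equiv.symm_apply_eq]
  rw [this, Finset.sum_singleton]

/-- A set of outcomes of a test can be joined into one transformation. -/
theorem exists_sum (T : OPT Sys) {A B : Sys} {Y : Type} [Finite Y] (D : Y → (A ⟶ B))
    (hD : T.IsTest D) (s : Finset Y) (hs : s.Nonempty) :
    ∃ f : A ⟶ B, T.vec f = ∑ y ∈ s, T.vec (D y) := by
  classical
  have := Fintype.ofFinite Y
  obtain ⟨y0, hy0⟩ := hs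
  by_cases hu : ∃ y, y ∉ s
  · obtain ⟨y1, hy1⟩ := hu
    obtain ⟨C, -, h⟩ := T.test_coarse D (fun y => decide (y ∈ s)) hD (by
      rintro (_ | _)
      · exact ⟨y1, by simpa using hy1⟩
      · exact ⟨y0, by simpa using hy0⟩)
    refine ⟨C true, ?_⟩
    rw [h]
    congr 1
    ext y; simp
  · push Not at hu
    obtain ⟨C, -, h⟩ := T.test_coarse D (fun _ => ()) hD (fun _ => ⟨y0, rfl⟩)
    refine ⟨C (), ?_⟩
    rw [h]
    congr 1
    ext y; simp [hu]

/-- The multiple of the identity by the probability of a scalar, obtained by putting the scalar in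
parallel. -/
def scale (c : 𝟙_ Sys ⟶ 𝟙_ Sys) (B : Sys) : B ⟶ B := (λ_ B).inv ≫ c ▷ B ≫ (λ_ B).hom

theorem scale_test (T : OPT Sys) (B : Sys) (c : Bool → (𝟙_ Sys ⟶ 𝟙_ Sys)) (hc : T.IsTest c) :
    T.IsTest (fun b => scale (c b) B) := by
  have h1 := T.test_par c (fun _ : Unit => 𝟙 B) hc (T.channel_id B)
  have h2 := T.test_seq _ (fun _ (_ : Unit) => (λ_ B).hom) h1 (fun _ => T.channel_leftUnitor_hom B)
  have h3 := T.test_seq (fun _ : Unit => (λ_ B).inv) (fun _ => _) (T.channel_leftUnitor_inv B)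
    (fun _ => h2)
  have h4 := T.test_reindex _ h3
    (X := Bool) ⟨fun b => ⟨(), ⟨(b, ()), ()⟩⟩, fun p => p.2.1.1, fun _ => rfl, fun _ => rfl⟩
  simpa [scale] using h4

/-- Every transformation is one of the outcomes of a test with two outcomes. -/
theorem exists_binary (T : OPT Sys) {A B : Sys} (f : A ⟶ B) :
    ∃ g : A ⟶ B, T.IsTest (fun b : Bool => cond b f g) := by
  classical
  obtain ⟨X, _, D, x0, hD, rfl⟩ := T.exists_test f
  have := Fintype.ofFinite X
  obtain ⟨c, hc, hc1⟩ := T.test_coin 1 zero_le_one le_rfl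
  -- an outcome of probability zero is appended, in case the test of `f` has no other outcome
  have h1 := T.test_seq D (fun _ => _) hD (fun _ => T.scale_test B c hc)
  obtain ⟨C, hC, h⟩ := T.test_coarse _ (fun p : (_ : X) × Bool => decide (p.1 = x0 ∧ p.2 = true))
    h1 (by
      rintro (_ | _)
      · exact ⟨⟨x0, false⟩, by simp⟩
      · exact ⟨⟨x0, true⟩, by simp⟩)
  have h2 : C true = D x0 := by
    apply T.separation
    rw [h]
    have : (Finset.univ.filter fun y : (_ : X) × Bool => decide (y.1 = x0 ∧ y.2 = true) = true)
        = {⟨x0, true⟩} := by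
      ext ⟨x, b⟩
      simp [Sigma.ext_iff]
    rw [this, Finset.sum_singleton]
    simp [T.scalar_eq_id hc1, scale]
  refine ⟨C false, ?_⟩
  convert hC using 2 with b
  cases b <;> simp [h2]

/-- A test with two outcomes followed by one of two tests, according to the outcome. -/
theorem test_branch (T : OPT Sys) {A B C : Sys} {X X' : Type} [Finite X] [Finite X']
    (f g : A ⟶ B) (hfg : T.IsTest (fun b : Bool => cond b f g)) (E : X → (B ⟶ C))
    (E' : X' → (B ⟶ C)) (hE : T.IsTest E) (hE' : T.IsTest E') :
    T.IsTest (Sum.elim (fun x => f ≫ E x) (fun x => g ≫ E' x)) := by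
  let Y : Bool → Type := fun b => cond b X X'
  have : ∀ b : Bool, Finite (Y b) := by
    rintro (_ | _)
    · exact ‹Finite X'›
    · exact ‹Finite X›
  let F : ∀ b, Y b → (B ⟶ C) := fun b =>
    match b with
    | true => E
    | false => E'
  have hF : ∀ b : Bool, @OPTData.IsTest _ _ _ _ T.toOPTData B C (Y b) (this b) (F b) := by
    rintro (_ | _)
    · exact hE'
    · exact hE
  have h1 := @T.test_seq A B C Bool _ Y this _ F hfg hF
  let π : X ⊕ X' → (b : Bool) × Y b := Sum.elim (fun x => ⟨true, x⟩) (fun x => ⟨false, x⟩)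
  have hπ : Function.Bijective π := by
    constructor
    · rintro (x | x) (y | y) h <;> simp [π] at h <;> simp [h]
    · rintro ⟨_ | _, x⟩
      · exact ⟨Sum.inr x, rfl⟩
      · exact ⟨Sum.inl x, rfl⟩
  have h2 := T.test_reindex _ h1 (Equiv.ofBijective π hπ)
  convert h2 using 2 with x
  rcases x with x | x <;> rfl

theorem exists_channel_effect {T : OPT Sys} (hT : T.IsSharpWithPurification) (A : Sys) :
    ∃ e : A ⟶ 𝟙_ Sys, T.IsChannel e := by
  classical
  obtain ⟨a, -, -⟩ := hT.pureSharpness A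
  obtain ⟨X, _, D, x0, hD, -⟩ := T.exists_test a
  have := Fintype.ofFinite X
  obtain ⟨C, hC, -⟩ := T.test_coarse D (fun _ => ()) hD (fun _ => ⟨x0, rfl⟩)
  exact ⟨C (), hC⟩

/-- The deterministic effect of a system; causality makes it unique. -/
noncomputable def discard {T : OPT Sys} (hT : T.IsSharpWithPurification) (A : Sys) : A ⟶ 𝟙_ Sys :=
  (exists_channel_effect hT A).choose

variable {T : OPT Sys} (hT : T.IsSharpWithPurification)

theorem discard_channel (A : Sys) : T.IsChannel (discard hT A) :=
  (exists_channel_effect hT A).choose_spec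

theorem sum_pair_test {A : Sys} {X : Type} [Fintype X] {a : X → (A ⟶ 𝟙_ Sys)} (ha : T.IsTest a)
    (ρ : 𝟙_ Sys ⟶ A) : ∑ x, T.pair (a x) ρ = T.pair (discard hT A) ρ := by
  simpa using hT.causality A ρ X Unit a (fun _ => discard hT A) ha (discard_channel hT A)

theorem channel_eq_discard {A : Sys} {e : A ⟶ 𝟙_ Sys} (he : T.IsChannel e) : e = discard hT A :=
  T.effect_ext fun ρ => by simpa using sum_pair_test hT (a := fun _ : Unit => e) he ρ

theorem channel_comp {A B C : Sys} {f : A ⟶ B} {g : B ⟶ C} (hf : T.IsChannel f)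
    (hg : T.IsChannel g) : T.IsChannel (f ≫ g) :=
  T.test_reindex (X := Unit) _ (T.test_seq (fun _ : Unit => f) (fun _ (_ : Unit) => g) hf
    (fun _ => hg)) ⟨fun _ => ⟨(), ()⟩, fun _ => (), fun _ => rfl, fun _ => rfl⟩

theorem channel_tensor {A B C D : Sys} {f : A ⟶ B} {g : C ⟶ D} (hf : T.IsChannel f)
    (hg : T.IsChannel g) : T.IsChannel (f ⊗ₘ g) :=
  T.test_reindex (X := Unit) _ (T.test_par (fun _ : Unit => f) (fun _ : Unit => g) hf hg)
    ⟨fun _ => ((), ()), fun _ => (), fun _ => rfl, fun _ => rfl⟩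

theorem channel_whiskerLeft (A : Sys) {C D : Sys} {g : C ⟶ D} (hg : T.IsChannel g) :
    T.IsChannel (A ◁ g) := by
  simpa using channel_tensor (T.channel_id A) hg

theorem channel_whiskerRight {A B : Sys} (C : Sys) {f : A ⟶ B} (hf : T.IsChannel f) :
    T.IsChannel (f ▷ C) := by
  simpa using channel_tensor hf (T.channel_id C)

theorem channel_comp_discard {A B : Sys} {f : A ⟶ B} (hf : T.IsChannel f) :
    f ≫ discard hT B = discard hT A :=
  channel_eq_discard hT (channel_comp hf (discard_channel hT B))

/-- Probabilities of a test add up to the probability of its input. -/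
theorem binary_discard {A B : Sys} {f g : A ⟶ B} (h : T.IsTest (fun b : Bool => cond b f g))
    (ρ : 𝟙_ Sys ⟶ A) : T.pair (discard hT B) (ρ ≫ f) + T.pair (discard hT B) (ρ ≫ g) =
      T.pair (discard hT A) ρ := by
  have h1 := T.test_branch f g h (fun _ : Unit => discard hT B) (fun _ : Unit => discard hT B)
    (discard_channel hT B) (discard_channel hT B)
  have h2 := sum_pair_test hT h1 ρ
  simpa [pair_comp] using h2

theorem discard_comp_le {A B : Sys} (f : A ⟶ B) (ρ : 𝟙_ Sys ⟶ A) :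
    T.pair (discard hT B) (ρ ≫ f) ≤ T.pair (discard hT A) ρ := by
  obtain ⟨g, hg⟩ := T.exists_binary f
  have := binary_discard hT hg ρ
  have := T.pair_nonneg (discard hT B) (ρ ≫ g)
  linarith

theorem exists_compl {A : Sys} (a : A ⟶ 𝟙_ Sys) :
    ∃ b : A ⟶ 𝟙_ Sys, ∀ ρ, T.pair a ρ + T.pair b ρ = T.pair (discard hT A) ρ := by
  obtain ⟨g, hg⟩ := T.exists_binary a
  refine ⟨g, fun ρ => ?_⟩
  simpa using sum_pair_test hT hg ρ

theorem pair_le_discard {A : Sys} (a : A ⟶ 𝟙_ Sys) (ρ : 𝟙_ Sys ⟶ A) :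
    T.pair a ρ ≤ T.pair (discard hT A) ρ := by
  obtain ⟨b, hb⟩ := exists_compl hT a
  have := hb ρ
  have := T.pair_nonneg b ρ
  linarith

theorem discard_unit : discard hT (𝟙_ Sys) = 𝟙 (𝟙_ Sys) :=
  T.scalar_eq_id (T.prob_channel (discard_channel hT _))

theorem discard_le_one {A : Sys} (ρ : 𝟙_ Sys ⟶ A) : T.pair (discard hT A) ρ ≤ 1 := by
  have h := discard_comp_le hT ρ (𝟙 _)
  rw [Category.id_comp, discard_unit] at h
  simpa [OPTData.pair, T.prob_id] using h

theorem isNormState_iff {A : Sys} (ρ : 𝟙_ Sys ⟶ A) :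
    T.IsNormState ρ ↔ T.pair (discard hT A) ρ = 1 := by
  have : (⨆ a : A ⟶ 𝟙_ Sys, T.pair a ρ) = T.pair (discard hT A) ρ := by
    have : Nonempty (A ⟶ 𝟙_ Sys) := ⟨discard hT A⟩
    apply le_antisymm
    · exact ciSup_le fun a => pair_le_discard hT a ρ
    · exact le_ciSup (f := fun a : A ⟶ 𝟙_ Sys => T.pair a ρ)
        ⟨_, by rintro _ ⟨a, rfl⟩; exact pair_le_discard hT a ρ⟩ (discard hT A)
  rw [IsNormState, this]

theorem isNormEffect_of_pair_eq_one {A : Sys} {a : A ⟶ 𝟙_ Sys} {ρ : 𝟙_ Sys ⟶ A}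
    (h : T.pair a ρ = 1) (hT : T.IsSharpWithPurification) : T.IsNormEffect a := by
  have : Nonempty (𝟙_ Sys ⟶ A) := ⟨ρ⟩
  have hle : ∀ σ, T.pair a σ ≤ 1 := fun σ =>
    (pair_le_discard hT a σ).trans (discard_le_one hT σ)
  apply le_antisymm
  · exact ciSup_le hle
  · rw [← h]
    exact le_ciSup (f := fun σ : 𝟙_ Sys ⟶ A => T.pair a σ)
        ⟨_, by rintro _ ⟨a, rfl⟩; exact hle a⟩ ρ

theorem eq_of_discard_eq_zero {A : Sys} {ρ : 𝟙_ Sys ⟶ A} (h : T.pair (discard hT A) ρ = 0)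
    (a : A ⟶ 𝟙_ Sys) : T.pair a ρ = 0 :=
  le_antisymm (h ▸ pair_le_discard hT a ρ) (T.pair_nonneg a ρ)

/-! ### Normalisation and mixtures of states -/

theorem exists_scalar (T : OPT Sys) {c : ℝ} (h0 : 0 ≤ c) (h1 : c ≤ 1) :
    ∃ s : 𝟙_ Sys ⟶ 𝟙_ Sys, T.prob s = c := by
  obtain ⟨s, -, hs⟩ := T.test_coin c h0 h1
  exact ⟨_, hs⟩

theorem exists_state (A : Sys) (hT : T.IsSharpWithPurification) :
    ∃ ρ : 𝟙_ Sys ⟶ A, T.pair (discard hT A) ρ = 1 := by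
  obtain ⟨a, -, ρ, h⟩ := hT.pureSharpness A
  exact ⟨ρ, le_antisymm (discard_le_one hT ρ) (h ▸ pair_le_discard hT a ρ)⟩

/-- Repeating once the preparation of a state if the first attempt fails. -/
theorem exists_retry {A : Sys} (ρ : 𝟙_ Sys ⟶ A) (hT : T.IsSharpWithPurification) :
    ∃ ρ' : 𝟙_ Sys ⟶ A, ∀ a, T.pair a ρ' = (2 - T.pair (discard hT A) ρ) * T.pair a ρ := by
  obtain ⟨g, hg⟩ := T.exists_binary ρ
  have h1 := T.test_branch ρ g hg (fun _ : Unit => 𝟙 A)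
    (fun b => discard hT A ≫ cond b ρ g) (T.channel_id A)
    (T.test_reindex (X := Bool) _ (T.test_seq (fun _ : Unit => discard hT A) (fun _ b => cond b ρ g)
      (discard_channel hT A) (fun _ => hg))
      ⟨fun b => ⟨(), b⟩, fun p => p.2, fun _ => rfl, fun _ => rfl⟩)
  obtain ⟨f, hf⟩ := T.exists_sum _ h1 {Sum.inl (), Sum.inr true} (by simp)
  refine ⟨f, fun a => ?_⟩
  have h2 := binary_discard hT hg (𝟙 _)
  simp only [Category.id_comp, discard_unit] at h2
  have h3 := pair_of_vec_eq_sum hf a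
  simp only [Finset.mem_singleton, reduceCtorEq, not_false_eq_true, Finset.sum_insert,
    Finset.sum_singleton, Sum.elim_inl, Sum.elim_inr, cond_true, Category.comp_id] at h3
  rw [h3, ← Category.assoc, T.pair_scalar]
  have h4 : T.pair (𝟙 (𝟙_ Sys)) (𝟙 _) = 1 := by simp [OPTData.pair, T.prob_id]
  have h5 : T.prob (g ≫ discard hT A) = 1 - T.pair (discard hT A) ρ := by
    rw [← h4, ← h2, OPTData.pair, OPTData.pair]
    ring
  rw [h5]; ring

theorem exists_zero (T : OPT Sys) {A : Sys} (ρ : 𝟙_ Sys ⟶ A) :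
    ∃ z : 𝟙_ Sys ⟶ A, ∀ a, T.pair a z = 0 := by
  obtain ⟨s, hs⟩ := T.exists_scalar (le_refl (0 : ℝ)) zero_le_one
  exact ⟨s ≫ ρ, fun a => by rw [T.pair_scalar, hs, zero_mul]⟩

/-- Every state is a multiple of a normalised one.  Among the multiples of the state, a largest
one exists because the set of states is closed; were it not normalised, preparing it again after
a failure would give a larger one. -/
theorem exists_normalized {A : Sys} (ρ : 𝟙_ Sys ⟶ A) : ∃ σ : 𝟙_ Sys ⟶ A,
    T.pair (discard hT A) σ = 1 ∧ ∀ a, T.pair a ρ = T.pair (discard hT A) ρ * T.pair a σ := by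
  rcases (T.pair_nonneg (discard hT A) ρ).eq_or_lt with h0 | hpos
  · obtain ⟨σ, hσ⟩ := exists_state A hT
    exact ⟨σ, hσ, fun a => by rw [← h0, zero_mul, eq_of_discard_eq_zero hT h0.symm]⟩
  set c := T.pair (discard hT A) ρ with hc
  let L : Set ℝ := Set.Icc 0 (1 / c) ∩ (fun l : ℝ => l • T.stVec ρ) ⁻¹' Set.range T.stVec
  have hL : IsCompact L := by
    refine isCompact_Icc.inter_right (IsClosed.preimage ?_ (T.closed_states A))
    fun_prop
  have hle : ∀ l, l • T.stVec ρ ∈ Set.range T.stVec → l ≤ 1 / c := by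
    rintro l ⟨σ, hσ⟩
    have h1 : T.pair (discard hT A) σ = l * c := congrFun hσ (discard hT A)
    rw [le_div_iff₀ hpos, ← h1]
    exact discard_le_one hT σ
  have hne : L.Nonempty := ⟨1, ⟨zero_le_one, hle 1 ⟨ρ, by simp⟩⟩, ρ, by simp⟩
  obtain ⟨l, ⟨hl, σ, hσ⟩, hmax⟩ := hL.exists_isGreatest hne
  have hσ' : ∀ a, T.pair a σ = l * T.pair a ρ := fun a => congrFun hσ a
  have hl1 : 1 ≤ l := hmax ⟨⟨zero_le_one, hle 1 ⟨ρ, by simp⟩⟩, ρ, by simp⟩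
  obtain ⟨τ, hτ⟩ := exists_retry σ hT
  have hmem : (2 - T.pair (discard hT A) σ) * l ∈ L := by
    have h1 : ((2 - T.pair (discard hT A) σ) * l) • T.stVec ρ ∈ Set.range T.stVec := by
      refine ⟨τ, funext fun a => ?_⟩
      change T.pair a τ = _ * T.pair a ρ
      rw [hτ, hσ' a, mul_assoc]
    refine ⟨⟨mul_nonneg ?_ hl.1, hle _ h1⟩, h1⟩
    linarith [discard_le_one hT σ]
  have h2 := hmax hmem
  have h3 : T.pair (discard hT A) σ = 1 := by
    refine le_antisymm (discard_le_one hT σ) ?_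
    nlinarith
  refine ⟨σ, h3, fun a => ?_⟩
  rw [hσ', ← mul_assoc, mul_comm c l, ← hσ', h3, one_mul]

theorem exists_mix {A : Sys} {c : ℝ} (h0 : 0 ≤ c) (h1 : c ≤ 1) (ρ σ : 𝟙_ Sys ⟶ A) :
    ∃ τ : 𝟙_ Sys ⟶ A, ∀ a, T.pair a τ = c * T.pair a ρ + (1 - c) * T.pair a σ := by
  obtain ⟨s, hs, hsc⟩ := T.test_coin c h0 h1
  obtain ⟨g, hg⟩ := T.exists_binary ρ
  obtain ⟨g', hg'⟩ := T.exists_binary σ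
  have hs2 : T.IsTest (fun b : Bool => cond b (s true) (s false)) := by
    convert hs using 2 with b
    cases b <;> rfl
  have hsum := T.prob_sum s hs
  rw [Fintype.sum_bool, hsc] at hsum
  obtain ⟨f, hf⟩ := T.exists_sum _ (T.test_branch _ _ hs2 _ _ hg hg')
    {Sum.inl true, Sum.inr true} (by simp)
  refine ⟨f, fun a => ?_⟩
  rw [pair_of_vec_eq_sum hf, Finset.sum_pair (by simp)]
  simp only [Sum.elim_inl, Sum.elim_inr, cond_true, T.pair_scalar, hsc]
  rw [show T.prob (s false) = 1 - c by linarith]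

theorem exists_add {A : Sys} {c d : ℝ} (hc : 0 ≤ c) (hd : 0 ≤ d) (ρ σ : 𝟙_ Sys ⟶ A)
    (h : c * T.pair (discard hT A) ρ + d * T.pair (discard hT A) σ ≤ 1) :
    ∃ τ : 𝟙_ Sys ⟶ A, ∀ a, T.pair a τ = c * T.pair a ρ + d * T.pair a σ := by
  obtain ⟨ρ', -, hρ⟩ := exists_normalized hT ρ
  obtain ⟨σ', -, hσ⟩ := exists_normalized hT σ
  set x := c * T.pair (discard hT A) ρ with hx
  set y := d * T.pair (discard hT A) σ with hy
  have hx0 : 0 ≤ x := mul_nonneg hc (T.pair_nonneg _ _)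
  have hy0 : 0 ≤ y := mul_nonneg hd (T.pair_nonneg _ _)
  have key : ∀ a, c * T.pair a ρ + d * T.pair a σ = x * T.pair a ρ' + y * T.pair a σ' := by
    intro a
    rw [hρ a, hσ a, hx, hy]; ring
  rcases (add_nonneg hx0 hy0).eq_or_lt with h0 | hpos
  · obtain ⟨z, hz⟩ := T.exists_zero ρ
    refine ⟨z, fun a => ?_⟩
    rw [key, hz, show x = 0 by linarith, show y = 0 by linarith]; ring
  · obtain ⟨τ, hτ⟩ := exists_mix (T := T) (div_nonneg hx0 hpos.le)
      ((div_le_one hpos).2 (by linarith)) ρ' σ'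
    obtain ⟨s, hs⟩ := T.exists_scalar hpos.le h
    refine ⟨s ≫ τ, fun a => ?_⟩
    rw [key, T.pair_scalar, hs, hτ]
    field_simp
    ring

theorem exists_finset_sum {A : Sys} {ι : Type*} (s : Finset ι) (c : ι → ℝ) (ρ : ι → (𝟙_ Sys ⟶ A))
    (hc : ∀ i ∈ s, 0 ≤ c i) (h : ∑ i ∈ s, c i * T.pair (discard hT A) (ρ i) ≤ 1) :
    ∃ τ : 𝟙_ Sys ⟶ A, ∀ a, T.pair a τ = ∑ i ∈ s, c i * T.pair a (ρ i) := by
  classical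
  induction s using Finset.induction_on with
  | empty =>
    obtain ⟨σ, -⟩ := exists_state A hT
    obtain ⟨z, hz⟩ := T.exists_zero σ
    exact ⟨z, by simpa using hz⟩
  | insert i s hi ih =>
    rw [Finset.sum_insert hi] at h
    have h0 := mul_nonneg (hc i (by simp)) (T.pair_nonneg (discard hT A) (ρ i))
    obtain ⟨τ, hτ⟩ := ih (fun j hj => hc j (by simp [hj])) (by linarith)
    obtain ⟨τ', hτ'⟩ := exists_add hT (hc i (by simp)) zero_le_one (ρ i) τ (by
      rw [one_mul, hτ]; exact h)
    exact ⟨τ', fun a => by rw [hτ', hτ, Finset.sum_insert hi, one_mul]⟩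

/-- The normalised states of a system, as vectors of probabilities. -/
def normStates (T : OPT Sys) (A : Sys) : Set ((A ⟶ 𝟙_ Sys) → ℝ) :=
  {x | ∃ ρ : 𝟙_ Sys ⟶ A, T.IsNormState ρ ∧ T.stVec ρ = x}

theorem convex_normStates (hT : T.IsSharpWithPurification) (A : Sys) :
    Convex ℝ (T.normStates A) := by
  rintro _ ⟨ρ, hρ, rfl⟩ _ ⟨σ, hσ, rfl⟩ a b ha hb hab
  obtain ⟨τ, hτ⟩ := exists_mix (T := T) ha (by linarith) ρ σ
  rw [← eq_sub_iff_add_eq'] at hab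
  rw [isNormState_iff hT] at hρ hσ
  refine ⟨τ, ?_, ?_⟩
  · rw [isNormState_iff hT, hτ, hρ, hσ]; ring
  · funext e
    simp only [OPTData.stVec, hτ, hab, Pi.add_apply, Pi.smul_apply, smul_eq_mul]

theorem normStates_subset_Icc (hT : T.IsSharpWithPurification) (A : Sys) :
    ∀ x ∈ T.normStates A, ∀ e, x e ∈ Set.Icc (0 : ℝ) 1 := by
  rintro _ ⟨ρ, -, rfl⟩ e
  exact ⟨T.pair_nonneg _ _, (pair_le_discard hT _ _).trans (discard_le_one hT _)⟩

theorem isCompact_normStates (hT : T.IsSharpWithPurification) (A : Sys) :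
    IsCompact (T.normStates A) := by
  have h1 : T.normStates A = Set.range T.stVec ∩ {x | x (discard hT A) = 1} := by
    ext x
    constructor
    · rintro ⟨ρ, hρ, rfl⟩
      exact ⟨⟨ρ, rfl⟩, (isNormState_iff hT ρ).1 hρ⟩
    · rintro ⟨⟨ρ, rfl⟩, hρ⟩
      exact ⟨ρ, (isNormState_iff hT ρ).2 hρ, rfl⟩
  have h2 : IsClosed (T.normStates A) := by
    rw [h1]
    exact (T.closed_states A).inter (isClosed_singleton.preimage (continuous_apply _))
  refine (isCompact_univ_pi
    (fun _ : A ⟶ 𝟙_ Sys => isCompact_Icc (a := (0 : ℝ)) (b := 1))).of_isClosed_subset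
    h2 fun x hx e _ => normStates_subset_Icc hT A x hx e

theorem finiteDimensional_span_normStates (T : OPT Sys) (A : Sys) :
    FiniteDimensional ℝ (Submodule.span ℝ (T.normStates A)) := by
  have := T.finite_dim A
  refine Submodule.finiteDimensional_of_le (Submodule.span_mono ?_ :
    _ ≤ Submodule.span ℝ (Set.range (T.stVec : (𝟙_ Sys ⟶ A) → _)))
  rintro _ ⟨ρ, -, rfl⟩
  exact ⟨ρ, rfl⟩

theorem nonempty_normStates (hT : T.IsSharpWithPurification) (A : Sys) :
    (T.normStates A).Nonempty := by
  obtain ⟨ρ, hρ⟩ := exists_state A hT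
  exact ⟨_, ρ, (isNormState_iff hT ρ).2 hρ, rfl⟩

/-! ### Conditioning of bipartite states -/

/-- The state of `A` left by the effect `b` on `B`, for a state of `A ⊗ B`. -/
def condR {A B : Sys} (b : B ⟶ 𝟙_ Sys) (Ψ : 𝟙_ Sys ⟶ A ⊗ B) : 𝟙_ Sys ⟶ A :=
  Ψ ≫ A ◁ b ≫ (ρ_ A).hom

/-- The state of `B` left by the effect `a` on `A`, for a state of `A ⊗ B`. -/
def condL {A B : Sys} (a : A ⟶ 𝟙_ Sys) (Ψ : 𝟙_ Sys ⟶ A ⊗ B) : 𝟙_ Sys ⟶ B :=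
  Ψ ≫ a ▷ B ≫ (λ_ B).hom

theorem pair_condR_eq (T : OPT Sys) {A B : Sys} (a : A ⟶ 𝟙_ Sys) (b : B ⟶ 𝟙_ Sys)
    (Ψ : 𝟙_ Sys ⟶ A ⊗ B) : T.pair a (condR b Ψ) = T.pair b (condL a Ψ) := by
  simp only [OPTData.pair, condR, condL, Category.assoc]
  rw [← rightUnitor_naturality, ← leftUnitor_naturality, whisker_exchange_assoc, unitors_equal]

omit [SymmetricCategory Sys] in
theorem condR_whiskerLeft {A B C : Sys} (K : B ⟶ C) (b : C ⟶ 𝟙_ Sys) (Ψ : 𝟙_ Sys ⟶ A ⊗ B) :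
    condR b (Ψ ≫ A ◁ K) = condR (K ≫ b) Ψ := by
  simp [condR]

omit [SymmetricCategory Sys] in
theorem condR_whiskerRight {A B C : Sys} (P : A ⟶ C) (b : B ⟶ 𝟙_ Sys) (Ψ : 𝟙_ Sys ⟶ A ⊗ B) :
    condR b (Ψ ≫ P ▷ B) = condR b Ψ ≫ P := by
  simp only [condR, Category.assoc]
  rw [← rightUnitor_naturality, whisker_exchange_assoc]

omit [SymmetricCategory Sys] in
theorem condL_whiskerRight {A B C : Sys} (P : A ⟶ C) (a : C ⟶ 𝟙_ Sys) (Ψ : 𝟙_ Sys ⟶ A ⊗ B) :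
    condL a (Ψ ≫ P ▷ B) = condL (P ≫ a) Ψ := by
  simp [condL]

omit [SymmetricCategory Sys] in
theorem condL_whiskerLeft {A B C : Sys} (K : B ⟶ C) (a : A ⟶ 𝟙_ Sys) (Ψ : 𝟙_ Sys ⟶ A ⊗ B) :
    condL a (Ψ ≫ A ◁ K) = condL a Ψ ≫ K := by
  simp only [condL, Category.assoc]
  rw [← leftUnitor_naturality, ← whisker_exchange_assoc]

theorem condR_braiding {A B : Sys} (a : A ⟶ 𝟙_ Sys) (Ψ : 𝟙_ Sys ⟶ A ⊗ B) :
    condR a (Ψ ≫ (β_ A B).hom) = condL a Ψ := by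
  simp only [condR, condL, Category.assoc]
  rw [← BraidedCategory.braiding_naturality_left_assoc, braiding_rightUnitor]

theorem condL_braiding {A B : Sys} (b : B ⟶ 𝟙_ Sys) (Ψ : 𝟙_ Sys ⟶ A ⊗ B) :
    condL b (Ψ ≫ (β_ A B).hom) = condR b Ψ := by
  simp only [condR, condL, Category.assoc]
  rw [← BraidedCategory.braiding_naturality_right_assoc, braiding_leftUnitor]

/-- The tensor product of two states. -/
def prodState {A B : Sys} (ρ : 𝟙_ Sys ⟶ A) (σ : 𝟙_ Sys ⟶ B) : 𝟙_ Sys ⟶ A ⊗ B :=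
  (λ_ (𝟙_ Sys)).inv ≫ (ρ ⊗ₘ σ)

omit [SymmetricCategory Sys] in
theorem condR_prodState {A B : Sys} (ρ : 𝟙_ Sys ⟶ A) (σ : 𝟙_ Sys ⟶ B) (b : B ⟶ 𝟙_ Sys) :
    condR b (prodState ρ σ) = (σ ≫ b) ≫ ρ := by
  simp only [condR, prodState, Category.assoc]
  rw [tensorHom_def', Category.assoc, ← whisker_exchange_assoc, rightUnitor_naturality]
  simp [← unitors_equal]

omit [SymmetricCategory Sys] in
theorem condL_prodState {A B : Sys} (ρ : 𝟙_ Sys ⟶ A) (σ : 𝟙_ Sys ⟶ B) (a : A ⟶ 𝟙_ Sys) :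
    condL a (prodState ρ σ) = (ρ ≫ a) ≫ σ := by
  simp only [condL, prodState, Category.assoc]
  rw [MonoidalCategory.tensorHom_def, Category.assoc, whisker_exchange_assoc,
    leftUnitor_naturality]
  simp [unitors_equal, unitors_inv_equal]

theorem whiskerLeft_discard (A B : Sys) :
    A ◁ discard hT B ≫ (ρ_ A).hom ≫ discard hT A = discard hT (A ⊗ B) := by
  apply channel_eq_discard
  exact channel_comp (channel_whiskerLeft A (discard_channel hT B))
    (channel_comp (T.channel_rightUnitor_hom A) (discard_channel hT A))

theorem whiskerRight_discard (A B : Sys) :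
    discard hT A ▷ B ≫ (λ_ B).hom ≫ discard hT B = discard hT (A ⊗ B) := by
  apply channel_eq_discard
  exact channel_comp (channel_whiskerRight B (discard_channel hT A))
    (channel_comp (T.channel_leftUnitor_hom B) (discard_channel hT B))

theorem pair_discard_condR {A B : Sys} (Ψ : 𝟙_ Sys ⟶ A ⊗ B) :
    T.pair (discard hT A) (condR (discard hT B) Ψ) = T.pair (discard hT (A ⊗ B)) Ψ := by
  rw [← whiskerLeft_discard]
  simp [condR, OPTData.pair]

theorem pair_discard_condL {A B : Sys} (Ψ : 𝟙_ Sys ⟶ A ⊗ B) :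
    T.pair (discard hT B) (condL (discard hT A) Ψ) = T.pair (discard hT (A ⊗ B)) Ψ := by
  rw [← pair_condR_eq, pair_discard_condR]

theorem isMarginal_iff {A B : Sys} {Ψ : 𝟙_ Sys ⟶ A ⊗ B} {ρ : 𝟙_ Sys ⟶ A} :
    T.IsMarginal Ψ ρ ↔ condR (discard hT B) Ψ = ρ := by
  constructor
  · rintro ⟨e, he, h⟩
    rwa [channel_eq_discard hT he] at h
  · intro h
    exact ⟨_, discard_channel hT B, h⟩

theorem exists_purification {A : Sys} {ρ : 𝟙_ Sys ⟶ A} (hρ : T.pair (discard hT A) ρ = 1) :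
    ∃ (B : Sys) (Ψ : 𝟙_ Sys ⟶ A ⊗ B), T.pair (discard hT (A ⊗ B)) Ψ = 1 ∧ T.IsPure Ψ ∧
      condR (discard hT B) Ψ = ρ := by
  obtain ⟨B, Ψ, h1, h2, h3⟩ := hT.purification.1 A ρ ((isNormState_iff hT ρ).2 hρ)
  exact ⟨B, Ψ, (isNormState_iff hT Ψ).1 h1, h2, (isMarginal_iff hT).1 h3⟩

theorem purification_unique {A B : Sys} {Ψ Ψ' : 𝟙_ Sys ⟶ A ⊗ B} (hP : T.IsPure Ψ)
    (hP' : T.IsPure Ψ') (hn : T.pair (discard hT (A ⊗ B)) Ψ = 1)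
    (h : condR (discard hT B) Ψ = condR (discard hT B) Ψ') :
    ∃ U : B ⟶ B, T.IsReversible U ∧ Ψ' = Ψ ≫ A ◁ U := by
  have hn' : T.pair (discard hT (A ⊗ B)) Ψ' = 1 := by
    rw [← pair_discard_condR, ← h, pair_discard_condR, hn]
  refine hT.purification.2 A B (condR (discard hT B) Ψ) Ψ Ψ' ?_ ?_ ?_
  · rw [isNormState_iff hT, pair_discard_condR, hn]
  · exact ⟨(isNormState_iff hT Ψ).2 hn, hP, (isMarginal_iff hT).2 rfl⟩
  · exact ⟨(isNormState_iff hT Ψ').2 hn', hP', (isMarginal_iff hT).2 h.symm⟩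

/-! ### Purity of identities and of reversible channels -/

theorem vec_comp (T : OPT Sys) {A B C : Sys} (f : A ⟶ B) (g : B ⟶ C) (S : Sys)
    (φ : 𝟙_ Sys ⟶ A ⊗ S) (E : C ⊗ S ⟶ 𝟙_ Sys) :
    T.vec (f ≫ g) S φ E = T.vec f S φ (g ▷ S ≫ E) := by
  simp [OPTData.vec, OPTData.pair]

theorem test_whiskerRight {A B : Sys} {Y : Type} [Finite Y] {D : Y → (A ⟶ B)} (hD : T.IsTest D)
    (S : Sys) : T.IsTest (fun y => D y ▷ S) := by
  have h := T.test_reindex (X := Y) _ (T.test_par D (fun _ : Unit => 𝟙 S) hD (T.channel_id S))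
    ⟨fun y => (y, ()), fun p => p.1, fun _ => rfl, fun _ => rfl⟩
  simpa using h

theorem test_comp_channel {A B C : Sys} {Y : Type} [Finite Y] {D : Y → (A ⟶ B)} (hD : T.IsTest D)
    {f : B ⟶ C} (hf : T.IsChannel f) : T.IsTest (fun y => D y ≫ f) :=
  T.test_reindex (X := Y) _ (T.test_seq D (fun _ (_ : Unit) => f) hD fun _ => hf)
    ⟨fun y => ⟨y, ()⟩, fun p => p.1, fun _ => rfl, fun _ => rfl⟩

theorem test_channel_comp {A B : Sys} {Y : Type} [Finite Y] {D : Y → (A ⟶ B)} (hD : T.IsTest D)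
    {C : Sys} {f : C ⟶ A} (hf : T.IsChannel f) : T.IsTest (fun y => f ≫ D y) :=
  T.test_reindex (X := Y) _ (T.test_seq (fun _ : Unit => f) (fun _ => D) hf fun _ => hD)
    ⟨fun y => ⟨(), y⟩, fun p => p.2, fun _ => rfl, fun _ => rfl⟩

/-- A normalised state is prepared with certainty. -/
theorem isChannel_of_norm {A : Sys} {ρ : 𝟙_ Sys ⟶ A} (hρ : T.pair (discard hT A) ρ = 1) :
    T.IsChannel ρ := by
  classical
  obtain ⟨g, hg⟩ := T.exists_binary ρ
  have h2 := binary_discard hT hg (𝟙 _)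
  simp only [Category.id_comp, discard_unit, hρ] at h2
  have h4 : T.pair (𝟙 (𝟙_ Sys)) (𝟙 _) = 1 := by simp [OPTData.pair, T.prob_id]
  obtain ⟨C, hC, h⟩ := T.test_coarse _ (fun _ => ()) hg (fun _ => ⟨true, rfl⟩)
  have h5 : C () = ρ := by
    apply T.state_ext
    intro a
    rw [pair_of_vec_eq_sum (h ()) a]
    simp [eq_of_discard_eq_zero hT (show T.pair (discard hT A) g = 0 by linarith)]
  rw [← h5]
  exact hC

/-- If the identity of `A` is the sum of some outcomes of a test, each of them multiplies every
given state of a composite system by a number, because it does so for its purifications. -/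
theorem exists_eigenvalue {A : Sys} {Y : Type} [Finite Y] {D : Y → (A ⟶ A)} (hD : T.IsTest D)
    {s : Finset Y} (hs : s.Nonempty) (h : T.vec (𝟙 A) = ∑ y ∈ s, T.vec (D y)) (S : Sys)
    {ω : 𝟙_ Sys ⟶ A ⊗ S} (hω : T.pair (discard hT _) ω = 1) {y : Y} (hy : y ∈ s) :
    ∃ c : ℝ, ∀ e, T.pair e (ω ≫ D y ▷ S) = c * T.pair e ω := by
  obtain ⟨E, Ψ, hn, hP, rfl⟩ := exists_purification hT hω
  have hvec : T.vec Ψ = ∑ y ∈ s, T.vec (Ψ ≫ D y ▷ S ▷ E) := by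
    funext R φ F
    simp only [Finset.sum_apply, vec_state, pair_comp]
    set e := (ρ_ ((A ⊗ S) ⊗ E)).inv ≫ ((A ⊗ S) ⊗ E) ◁ (φ ≫ (λ_ R).hom) ≫ F
    have h1 : ∀ f : A ⟶ A, T.pair (f ▷ S ▷ E ≫ e) Ψ =
        T.vec f (S ⊗ E) (Ψ ≫ (α_ A S E).hom) ((α_ A S E).inv ≫ e) := by
      intro f
      simp [OPTData.vec, OPTData.pair]
    have h2 := h1 (𝟙 A)
    rw [h] at h2
    simpa [Finset.sum_apply, h1] using h2
  obtain ⟨p, -, -, hp⟩ := hP Y _ s (test_channel_comp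
    (test_whiskerRight (test_whiskerRight hD S) E) (isChannel_of_norm hT hn)) hs hvec
  refine ⟨p y, fun e => ?_⟩
  have h3 : ∀ e, T.pair e (Ψ ≫ D y ▷ S ▷ E) = p y * T.pair e Ψ := by
    intro e
    have h5 := T.pair_comp_eq_vec (Ψ ≫ D y ▷ S ▷ E) (𝟙 _) e
    rw [hp y hy, Pi.smul_apply, Pi.smul_apply, Pi.smul_apply, ← pair_comp_eq_vec] at h5
    simpa using h5
  have h4 : ∀ Ξ : 𝟙_ Sys ⟶ (A ⊗ S) ⊗ E, T.pair e (condR (discard hT E) Ξ) =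
      T.pair ((A ⊗ S) ◁ discard hT E ≫ (ρ_ (A ⊗ S)).hom ≫ e) Ξ := fun Ξ => by
    simp [condR, OPTData.pair]
  rw [← condR_whiskerRight, h4, h4, h3]

/-- The number by which an outcome of a decomposition of the identity multiplies the states is
the same for all states: compare two states with their mixture. -/
theorem eigenvalue_unique {A : Sys} {F : A ⟶ A}
    (h : ∀ ω, T.pair (discard hT A) ω = 1 → ∃ c : ℝ, ∀ e, T.pair e (ω ≫ F) = c * T.pair e ω)
    {ω ω' : 𝟙_ Sys ⟶ A} (hω : T.pair (discard hT A) ω = 1) (hω' : T.pair (discard hT A) ω' = 1) :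
    T.pair (discard hT A) (ω ≫ F) = T.pair (discard hT A) (ω' ≫ F) := by
  obtain ⟨τ, hτ⟩ := exists_mix (T := T) (c := 1 / 2) (by norm_num) (by norm_num) ω ω'
  obtain ⟨c, hc⟩ := h ω hω
  obtain ⟨c', hc'⟩ := h ω' hω'
  obtain ⟨d, hd⟩ := h τ (by rw [hτ, hω, hω']; norm_num)
  have h1 : ∀ e, c * T.pair e ω + c' * T.pair e ω' = d * (T.pair e ω + T.pair e ω') := by
    intro e
    have h2 := hd e
    rw [pair_comp, hτ, ← pair_comp, ← pair_comp, hc, hc', hτ] at h2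
    linarith
  have h2 := h1 (discard hT A)
  rw [hω, hω'] at h2
  by_cases hcc : c = c'
  · rw [hc, hc', hω, hω', hcc]
  · have : ω = ω' := T.state_ext fun e => by
      have h3 := h1 e
      have h4 : (c - c') * (T.pair e ω - T.pair e ω') = 0 := by
        have : d = (c + c') / 2 := by linarith
        rw [this] at h3; linarith
      rcases mul_eq_zero.1 h4 with h5 | h5
      · exact absurd (by linarith) hcc
      · linarith
    rw [this]

theorem isPure_id (A : Sys) (hT : T.IsSharpWithPurification) : T.IsPure (𝟙 A) := by
  intro Y _ D s hD hs h
  obtain ⟨ρ, hρ⟩ := exists_state A hT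
  refine ⟨fun y => T.pair (discard hT A) (ρ ≫ D y), fun y _ => T.pair_nonneg _ _, ?_, ?_⟩
  · rw [← pair_comp_of_vec_eq_sum h, Category.comp_id, hρ]
  intro y hy
  funext S φ E
  obtain ⟨φ', hφ', hφ⟩ := exists_normalized hT φ
  obtain ⟨σ, hσ⟩ := exists_state S hT
  have hσ1 : σ ≫ discard hT S = 𝟙 _ := T.scalar_eq_id hσ
  have hprod : T.pair (discard hT (A ⊗ S)) (prodState ρ σ) = 1 := by
    rw [← pair_discard_condR, condR_prodState, hσ1, Category.id_comp, hρ]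
  have h1 := eigenvalue_unique hT (F := D y ▷ S)
    (fun ω hω => exists_eigenvalue hT hD hs h S hω hy) hφ' hprod
  rw [← pair_discard_condR hT (prodState ρ σ ≫ _), condR_whiskerRight, condR_prodState, hσ1,
    Category.id_comp] at h1
  obtain ⟨c, hc⟩ := exists_eigenvalue hT hD hs h S hφ' hy
  have h2 := hc (discard hT _)
  rw [h1, hφ', mul_one] at h2
  simp only [OPTData.vec, Pi.smul_apply, smul_eq_mul, id_whiskerRight, Category.comp_id]
  rw [pair_comp, hφ, ← pair_comp, hc, h2, hφ E]
  ring

theorem isPure_of_inverse {A B : Sys} (hT : T.IsSharpWithPurification) {U : A ⟶ B} {V : B ⟶ A}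
    (hV : T.IsChannel V) (hUV : U ≫ V = 𝟙 A) (hVU : V ≫ U = 𝟙 B) : T.IsPure U := by
  intro Y _ D s hD hs h
  obtain ⟨p, hp0, hp1, hp⟩ := isPure_id A hT Y (fun y => D y ≫ V) s (test_comp_channel hD hV) hs (by
    rw [← hUV]
    funext S φ E
    simp only [Finset.sum_apply, vec_comp, h])
  refine ⟨p, hp0, hp1, fun y hy => ?_⟩
  funext S φ E
  have h1 := congrFun (congrFun (congrFun (hp y hy) S) φ) (U ▷ S ≫ E)
  simp only [Pi.smul_apply] at h1 ⊢
  rw [← vec_comp, ← vec_comp, Category.assoc, hVU, Category.comp_id, Category.id_comp] at h1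
  exact h1

theorem IsReversible.isPure {A : Sys} (hT : T.IsSharpWithPurification) {U : A ⟶ A}
    (hU : T.IsReversible U) : T.IsPure U := by
  obtain ⟨-, V, hV, h1, h2⟩ := hU
  exact isPure_of_inverse hT hV h1 h2

theorem isPure_whiskerRight {A B : Sys} (hT : T.IsSharpWithPurification) {f : A ⟶ B}
    (hf : T.IsPure f) (S : Sys) : T.IsPure (f ▷ S) := by
  simpa using hT.purityPreservation.2 f (𝟙 S) hf (isPure_id S hT)

theorem isPure_whiskerLeft {A B : Sys} (hT : T.IsSharpWithPurification) {f : A ⟶ B}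
    (hf : T.IsPure f) (S : Sys) : T.IsPure (S ◁ f) := by
  simpa using hT.purityPreservation.2 (𝟙 S) f (isPure_id S hT) hf

theorem isPure_comp {A B C : Sys} (hT : T.IsSharpWithPurification) {f : A ⟶ B} {g : B ⟶ C}
    (hf : T.IsPure f) (hg : T.IsPure g) : T.IsPure (f ≫ g) :=
  hT.purityPreservation.1 f g hf hg

theorem isPure_leftUnitor_hom (hT : T.IsSharpWithPurification) (A : Sys) :
    T.IsPure (λ_ A).hom :=
  isPure_of_inverse hT (T.channel_leftUnitor_inv A) (by simp) (by simp)

theorem isPure_leftUnitor_inv (hT : T.IsSharpWithPurification) (A : Sys) :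
    T.IsPure (λ_ A).inv :=
  isPure_of_inverse hT (T.channel_leftUnitor_hom A) (by simp) (by simp)

theorem isPure_rightUnitor_hom (hT : T.IsSharpWithPurification) (A : Sys) :
    T.IsPure (ρ_ A).hom :=
  isPure_of_inverse hT (T.channel_rightUnitor_inv A) (by simp) (by simp)

theorem isPure_rightUnitor_inv (hT : T.IsSharpWithPurification) (A : Sys) :
    T.IsPure (ρ_ A).inv :=
  isPure_of_inverse hT (T.channel_rightUnitor_hom A) (by simp) (by simp)

theorem isPure_associator_hom (hT : T.IsSharpWithPurification) (A B C : Sys) :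
    T.IsPure (α_ A B C).hom :=
  isPure_of_inverse hT (T.channel_associator_inv A B C) (by simp) (by simp)

theorem isPure_swap (hT : T.IsSharpWithPurification) (A B : Sys) :
    T.IsPure (β_ A B).hom :=
  isPure_of_inverse hT (T.channel_swap B A) (by simp) (by simp)

theorem isPure_condR {A B : Sys} (hT : T.IsSharpWithPurification) {b : B ⟶ 𝟙_ Sys}
    {Ψ : 𝟙_ Sys ⟶ A ⊗ B} (hb : T.IsPure b) (hΨ : T.IsPure Ψ) : T.IsPure (condR b Ψ) :=
  isPure_comp hT hΨ (isPure_comp hT (isPure_whiskerLeft hT hb A) (isPure_rightUnitor_hom hT A))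

theorem isPure_condL {A B : Sys} (hT : T.IsSharpWithPurification) {a : A ⟶ 𝟙_ Sys}
    {Ψ : 𝟙_ Sys ⟶ A ⊗ B} (ha : T.IsPure a) (hΨ : T.IsPure Ψ) : T.IsPure (condL a Ψ) :=
  isPure_comp hT hΨ (isPure_comp hT (isPure_whiskerRight hT ha B) (isPure_leftUnitor_hom hT B))

theorem isPure_prodState {A B : Sys} (hT : T.IsSharpWithPurification) {α : 𝟙_ Sys ⟶ A}
    {β : 𝟙_ Sys ⟶ B} (hα : T.IsPure α) (hβ : T.IsPure β) : T.IsPure (prodState α β) :=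
  isPure_comp hT (isPure_leftUnitor_inv hT _) (hT.purityPreservation.2 α β hα hβ)

/-! ### Pure states -/

/-- A normalised state occurring with nonzero weight in a pure state is equal to it. -/
theorem IsPure.eq_of_mix {A : Sys} {α ρ σ : 𝟙_ Sys ⟶ A} (hα : T.IsPure α)
    (hαn : T.pair (discard hT A) α = 1) (hρ : T.pair (discard hT A) ρ = 1) {c : ℝ} (h0 : 0 < c)
    (h1 : c ≤ 1)
    (h : ∀ a, T.pair a α = c * T.pair a ρ + (1 - c) * T.pair a σ) : ρ = α := by
  obtain ⟨s, hs, hsc⟩ := T.test_coin c h0.le h1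
  obtain ⟨g, hg⟩ := T.exists_binary ρ
  obtain ⟨g', hg'⟩ := T.exists_binary σ
  have hs2 : T.IsTest (fun b : Bool => cond b (s true) (s false)) := by
    convert hs using 2 with b
    cases b <;> rfl
  have hsum := T.prob_sum s hs
  rw [Fintype.sum_bool, hsc] at hsum
  obtain ⟨p, -, -, hp⟩ := hα _ _ {Sum.inl true, Sum.inr true} (T.test_branch _ _ hs2 _ _ hg hg')
    (by simp) (by
      rw [Finset.sum_pair (by simp)]
      funext S φ E
      simp only [Pi.add_apply, vec_state, h, Sum.elim_inl, Sum.elim_inr, cond_true, T.pair_scalar,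
        hsc]
      rw [show T.prob (s false) = 1 - c by linarith])
  have h2 : ∀ a, c * T.pair a ρ = p (Sum.inl true) * T.pair a α := by
    intro a
    have h5 := T.pair_comp_eq_vec (s true ≫ ρ) (𝟙 _) a
    have h6 := hp (Sum.inl true) (by simp)
    simp only [Sum.elim_inl, cond_true] at h6
    rw [h6, Pi.smul_apply, Pi.smul_apply, Pi.smul_apply, ← pair_comp_eq_vec] at h5
    simpa [T.pair_scalar, hsc] using h5
  have h3 := h2 (discard hT A)
  rw [hρ, hαn] at h3
  apply T.state_ext
  intro a
  have h4 := h2 a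
  rw [← mul_one (p _), ← h3, mul_one] at h4
  exact mul_left_cancel₀ h0.ne' h4

/-- A state that has a pure nonzero multiple is pure. -/
theorem IsPure.of_smul {A : Sys} {f β : 𝟙_ Sys ⟶ A} (hf : T.IsPure f) {q : ℝ} (hq : 0 < q)
    (hq1 : q ≤ 1) (h : ∀ a, T.pair a f = q * T.pair a β) : T.IsPure β := by
  intro Y _ D s hD hs hβ
  obtain ⟨c, hc, hcq⟩ := T.test_coin q hq.le hq1
  have h1 := T.test_seq c (fun _ => D) hc (fun _ => hD)
  let ι : Y ↪ (_ : Bool) × Y := ⟨fun y => ⟨true, y⟩, fun y y' h => by simpa using h⟩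
  have hvec : ∀ y, T.vec (c true ≫ D y) = q • T.vec (D y) := by
    intro y
    funext S φ E
    simp [vec_state, T.pair_scalar, hcq]
  have hfβ : T.vec f = q • T.vec β := by
    funext S φ E
    simp [vec_state, h]
  obtain ⟨p, hp0, hp1, hp⟩ := hf _ _ (s.map ι) h1 (by simpa using hs) (by
    rw [Finset.sum_map, hfβ, hβ, Finset.smul_sum]
    exact Finset.sum_congr rfl fun y _ => (hvec y).symm)
  refine ⟨fun y => p (ι y), fun y hy => hp0 _ (by simpa using hy), by rwa [Finset.sum_map] at hp1,
    fun y hy => ?_⟩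
  have h2 := hp (ι y) (by simpa using hy)
  have h3 : T.vec (c true ≫ D y) = p (ι y) • T.vec f := h2
  rw [hvec, hfβ, smul_comm] at h3
  exact smul_right_injective _ hq.ne' h3

/-- The extreme points of the normalised states are pure. -/
theorem isPure_of_mem_extremePoints (hT : T.IsSharpWithPurification) {A : Sys} {α : 𝟙_ Sys ⟶ A}
    (hα : T.stVec α ∈ (T.normStates A).extremePoints ℝ) : T.IsPure α := by
  classical
  obtain ⟨⟨α', hαn, hα'⟩, hext⟩ := hα
  obtain rfl := T.stVec_injective hα'
  rw [isNormState_iff hT] at hαn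
  intro Y _ D s hD hs h
  have hsum := fun a => pair_of_vec_eq_sum h a
  refine ⟨fun y => T.pair (discard hT A) (D y), fun _ _ => T.pair_nonneg _ _, ?_, fun y hy => ?_⟩
  · rw [← hsum, hαn]
  suffices h1 : ∀ a, T.pair a (D y) = T.pair (discard hT A) (D y) * T.pair a α' by
    funext S φ E
    simp only [vec_state, Pi.smul_apply, smul_eq_mul]
    exact h1 _
  have hsum' : ∀ a, T.pair a α' = T.pair a (D y) + ∑ z ∈ s.erase y, T.pair a (D z) := fun a => by
    rw [hsum, Finset.add_sum_erase _ (fun z => T.pair a (D z)) hy]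
  -- the remaining outcomes are joined into one state
  obtain ⟨r, hr⟩ := exists_finset_sum hT (s.erase y) (fun _ => 1) D (fun _ _ => zero_le_one) (by
    have := hsum' (discard hT A)
    have := T.pair_nonneg (discard hT A) (D y)
    simp only [one_mul]; linarith)
  simp only [one_mul] at hr
  simp only [← hr] at hsum'
  obtain ⟨σ, hσn, hσ⟩ := exists_normalized hT (D y)
  obtain ⟨τ, hτn, hτ⟩ := exists_normalized hT r
  set c := T.pair (discard hT A) (D y)
  set d := T.pair (discard hT A) r
  have hcd : c + d = 1 := by rw [← hαn, hsum']
  have hc0 : 0 ≤ c := T.pair_nonneg _ _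
  have hd0 : 0 ≤ d := T.pair_nonneg _ _
  intro a
  rw [hσ]
  rcases hc0.eq_or_lt with hc | hc
  · rw [← hc]; simp
  rcases hd0.eq_or_lt with hd | hd
  · rw [hsum', hτ, ← hd, hσ a]
    rw [← hd, add_zero] at hcd
    rw [hcd]; ring
  · have h2 := hext (x₁ := T.stVec σ) ⟨σ, (isNormState_iff hT σ).2 hσn, rfl⟩ (x₂ := T.stVec τ)
      ⟨τ, (isNormState_iff hT τ).2 hτn, rfl⟩ ⟨c, d, hc, hd, hcd, by
        funext e
        simp only [OPTData.stVec, Pi.add_apply, Pi.smul_apply, smul_eq_mul]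
        rw [hsum', hσ, hτ]⟩
    have h3 := T.stVec_injective h2
    rw [h3]

theorem exists_pure_state (A : Sys) (hT : T.IsSharpWithPurification) :
    ∃ α : 𝟙_ Sys ⟶ A, T.IsPure α ∧ T.pair (discard hT A) α = 1 := by
  obtain ⟨x, hx⟩ := (isCompact_normStates hT A).extremePoints_nonempty (nonempty_normStates hT A)
  obtain ⟨α, hα, rfl⟩ := hx.1
  exact ⟨α, isPure_of_mem_extremePoints hT hx, (isNormState_iff hT α).1 hα⟩

/-- Any two normalised pure states are connected by a reversible channel: they purify the same
state of the trivial system. -/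
theorem exists_reversible {A : Sys} {α α' : 𝟙_ Sys ⟶ A} (hα : T.IsPure α) (hα' : T.IsPure α')
    (hn : T.pair (discard hT A) α = 1) (hn' : T.pair (discard hT A) α' = 1) :
    ∃ U : A ⟶ A, T.IsReversible U ∧ α' = α ≫ U := by
  have key : ∀ β : 𝟙_ Sys ⟶ A, T.pair (discard hT A) β = 1 →
      condR (discard hT A) (β ≫ (λ_ A).inv) = 𝟙 _ := by
    intro β hβ
    have h1 : β ≫ discard hT A = 𝟙 _ := T.scalar_eq_id hβ
    have h2 : condR (discard hT A) (β ≫ (λ_ A).inv) = β ≫ discard hT A := by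
      simp [condR, unitors_inv_equal]
    rw [h2, h1]
  obtain ⟨U, hU, h⟩ := purification_unique hT (isPure_comp hT hα (isPure_leftUnitor_inv hT A))
    (isPure_comp hT hα' (isPure_leftUnitor_inv hT A)) (by
      rw [← pair_discard_condR, key α hn, discard_unit]
      simp [OPTData.pair, T.prob_id]) (by rw [key α hn, key α' hn'])
  refine ⟨U, hU, ?_⟩
  rw [Category.assoc, ← leftUnitor_inv_naturality, ← Category.assoc] at h
  exact (cancel_mono _).1 h

/-- A bipartite pure state with a pure marginal on `B` has a pure marginal on `A`. -/
theorem isPure_marginal {A B : Sys} {Ψ : 𝟙_ Sys ⟶ A ⊗ B} (hΨ : T.IsPure Ψ)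
    (hn : T.pair (discard hT (A ⊗ B)) Ψ = 1) (h : T.IsPure (condL (discard hT A) Ψ)) :
    T.IsPure (condR (discard hT B) Ψ) := by
  obtain ⟨α, hα, hαn⟩ := exists_pure_state A hT
  set β := condL (discard hT A) Ψ with hβ
  have hβn : T.pair (discard hT B) β = 1 := by rw [hβ, pair_discard_condL, hn]
  have hα1 : α ≫ discard hT A = 𝟙 _ := T.scalar_eq_id hαn
  have hβ1 : β ≫ discard hT B = 𝟙 _ := T.scalar_eq_id hβn
  obtain ⟨U, hU, h2⟩ := purification_unique hT (isPure_prodState hT h hα)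
    (isPure_comp hT hΨ (isPure_swap hT A B)) (by
      rw [← pair_discard_condR, condR_prodState, hα1, Category.id_comp, hβn])
    (by rw [condR_prodState, condR_braiding, hα1, Category.id_comp])
  have h3 : condR (discard hT B) Ψ = α ≫ U := by
    rw [← condL_braiding, h2, condL_whiskerLeft, condL_prodState, hβ1, Category.id_comp]
  rw [h3]
  exact isPure_comp hT hα (IsReversible.isPure hT hU)

theorem condL_eq_of_pair_eq_one {A B : Sys} {Ψ : 𝟙_ Sys ⟶ A ⊗ B}
    (hn : T.pair (discard hT (A ⊗ B)) Ψ = 1) {a : A ⟶ 𝟙_ Sys}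
    (ha : T.pair a (condR (discard hT B) Ψ) = 1) : condL a Ψ = condL (discard hT A) Ψ := by
  obtain ⟨b, hb⟩ := exists_compl hT a
  apply T.state_ext
  intro e
  rw [← pair_condR_eq, ← pair_condR_eq, ← hb]
  have h1 := hb (condR (discard hT B) Ψ)
  rw [ha, pair_discard_condR, hn] at h1
  have h2 : T.pair (discard hT B) (condL b Ψ) = 0 := by rw [← pair_condR_eq]; linarith
  rw [pair_condR_eq T b, eq_of_discard_eq_zero hT h2, add_zero]

/-- A normalised state on which a pure effect occurs with certainty is pure. -/
theorem isPure_of_pair_eq_one {A : Sys} {a : A ⟶ 𝟙_ Sys} (ha : T.IsPure a) {ρ : 𝟙_ Sys ⟶ A}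
    (h : T.pair a ρ = 1) (hT : T.IsSharpWithPurification) : T.IsPure ρ := by
  have hρ : T.pair (discard hT A) ρ = 1 :=
    le_antisymm (discard_le_one hT ρ) (h ▸ pair_le_discard hT a ρ)
  obtain ⟨B, Ψ, hn, hP, rfl⟩ := exists_purification hT hρ
  apply isPure_marginal hT hP hn
  rw [← condL_eq_of_pair_eq_one hT hn h]
  exact isPure_condL hT ha hP

theorem eq_of_pair_eq_one {A : Sys} {a : A ⟶ 𝟙_ Sys} (ha : T.IsPure a) {ρ σ : 𝟙_ Sys ⟶ A}
    (hρ : T.pair a ρ = 1) (hσ : T.pair a σ = 1) (hT : T.IsSharpWithPurification) : ρ = σ := by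
  have hn : ∀ τ : 𝟙_ Sys ⟶ A, T.pair a τ = 1 → T.pair (discard hT A) τ = 1 := fun τ h =>
    le_antisymm (discard_le_one hT τ) (h ▸ pair_le_discard hT a τ)
  obtain ⟨τ, hτ⟩ := exists_mix (T := T) (c := 1 / 2) (by norm_num) (by norm_num) ρ σ
  have h1 : T.pair a τ = 1 := by rw [hτ, hρ, hσ]; norm_num
  have hP := isPure_of_pair_eq_one ha h1 hT
  have h2 := hP.eq_of_mix hT (hn τ h1) (hn ρ hρ) (by norm_num) (by norm_num) hτ
  have h3 := hP.eq_of_mix hT (hn τ h1) (hn σ hσ) (c := 1 / 2) (σ := ρ) (by norm_num)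
    (by norm_num) (fun e => by rw [hτ]; ring)
  rw [h2, h3]

theorem exists_dagger {A : Sys} {α : 𝟙_ Sys ⟶ A} (hα : T.IsPure α)
    (hn : T.pair (discard hT A) α = 1) : ∃ a : A ⟶ 𝟙_ Sys, T.IsPure a ∧ T.pair a α = 1 := by
  obtain ⟨a, ha, ρ, hρ⟩ := hT.pureSharpness A
  have hρn : T.pair (discard hT A) ρ = 1 :=
    le_antisymm (discard_le_one hT ρ) (hρ ▸ pair_le_discard hT a ρ)
  obtain ⟨U, hU, rfl⟩ := exists_reversible hT hα (isPure_of_pair_eq_one ha hρ hT) hn hρn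
  exact ⟨U ≫ a, isPure_comp hT (IsReversible.isPure hT hU) ha, by rwa [← pair_comp]⟩

/-! ### Purifications with different purifying systems -/

/-- Two purifications of a state, with arbitrary purifying systems, are related by a pure
transformation of the purifying systems: enlarge both purifying systems to `B ⊗ C` by adding pure
states, and remove `B` again by a pure effect. -/
theorem exists_pure_comp_purification {A B C : Sys} {Ψ : 𝟙_ Sys ⟶ A ⊗ B} {Ψ' : 𝟙_ Sys ⟶ A ⊗ C}
    (hP : T.IsPure Ψ) (hP' : T.IsPure Ψ') (hn : T.pair (discard hT (A ⊗ B)) Ψ = 1)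
    (h : condR (discard hT B) Ψ = condR (discard hT C) Ψ') :
    ∃ K : B ⟶ C, T.IsPure K ∧ Ψ' = Ψ ≫ A ◁ K := by
  obtain ⟨β, hβ, hβn⟩ := exists_pure_state B hT
  obtain ⟨γ, hγ, hγn⟩ := exists_pure_state C hT
  obtain ⟨b, hb, hbβ⟩ := exists_dagger hT hβ hβn
  let i : B ⟶ B ⊗ C := (ρ_ B).inv ≫ B ◁ γ
  let j : C ⟶ B ⊗ C := (λ_ C).inv ≫ β ▷ C
  have hi : T.IsPure i := isPure_comp hT (isPure_rightUnitor_inv hT B) (isPure_whiskerLeft hT hγ B)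
  have hj : T.IsPure j := isPure_comp hT (isPure_leftUnitor_inv hT C) (isPure_whiskerRight hT hβ C)
  have hi1 : i ≫ discard hT (B ⊗ C) = discard hT B := channel_comp_discard hT
    (channel_comp (T.channel_rightUnitor_inv B) (channel_whiskerLeft B (isChannel_of_norm hT hγn)))
  have hj1 : j ≫ discard hT (B ⊗ C) = discard hT C := channel_comp_discard hT
    (channel_comp (T.channel_leftUnitor_inv C) (channel_whiskerRight C (isChannel_of_norm hT hβn)))
  obtain ⟨U, hU, h2⟩ := purification_unique hT (isPure_comp hT hP (isPure_whiskerLeft hT hi A))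
    (isPure_comp hT hP' (isPure_whiskerLeft hT hj A))
    (by rw [← pair_discard_condR, condR_whiskerLeft, hi1, pair_discard_condR, hn])
    (by rw [condR_whiskerLeft, condR_whiskerLeft, hi1, hj1, h])
  let k : B ⊗ C ⟶ C := b ▷ C ≫ (λ_ C).hom
  have hk : T.IsPure k := isPure_comp hT (isPure_whiskerRight hT hb C) (isPure_leftUnitor_hom hT C)
  have hβb : β ≫ b = 𝟙 _ := T.scalar_eq_id hbβ
  have hjk : j ≫ k = 𝟙 C := by
    simp only [j, k, Category.assoc, ← comp_whiskerRight_assoc, hβb]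
    simp
  refine ⟨i ≫ U ≫ k, isPure_comp hT hi (isPure_comp hT (IsReversible.isPure hT hU) hk), ?_⟩
  have h3 : Ψ' = (Ψ' ≫ A ◁ j) ≫ A ◁ k := by
    rw [Category.assoc, ← MonoidalCategory.whiskerLeft_comp, hjk]; simp
  rw [h3, h2]
  simp

/-! ### The invariant state -/

/-- `γ` occurs with weight `r` in some decomposition of `τ` as a sum of states. -/
def HasWeight (T : OPT Sys) {A : Sys} (r : ℝ) (γ τ : 𝟙_ Sys ⟶ A) : Prop :=
  ∃ ν : 𝟙_ Sys ⟶ A, ∀ a, T.pair a τ = r * T.pair a γ + T.pair a ν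

/-- An internal state: all normalised states have a common positive weight in it. -/
def IsInternal (T : OPT Sys) {A : Sys} (χ : 𝟙_ Sys ⟶ A) : Prop :=
  ∃ l : ℝ, 0 < l ∧ ∀ ρ : 𝟙_ Sys ⟶ A, T.IsNormState ρ → T.HasWeight l ρ χ

theorem HasWeight.le {A : Sys} {r : ℝ} {γ τ : 𝟙_ Sys ⟶ A} (h : T.HasWeight r γ τ)
    (a : A ⟶ 𝟙_ Sys) : r * T.pair a γ ≤ T.pair a τ := by
  obtain ⟨ν, hν⟩ := h
  have := hν a
  have := T.pair_nonneg a ν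
  linarith

theorem IsReversible.exists_inverse {A : Sys} {U : A ⟶ A} (hU : T.IsReversible U) :
    ∃ V : A ⟶ A, T.IsReversible V ∧ U ≫ V = 𝟙 A ∧ V ≫ U = 𝟙 A := by
  obtain ⟨h1, V, hV, h2, h3⟩ := hU
  exact ⟨V, ⟨hV, U, h1, h3, h2⟩, h2, h3⟩

theorem IsReversible.comp {A : Sys} {U V : A ⟶ A}
    (hU : T.IsReversible U) (hV : T.IsReversible V) : T.IsReversible (U ≫ V) := by
  obtain ⟨h1, U', hU', h2, h3⟩ := hU
  obtain ⟨h4, V', hV', h5, h6⟩ := hV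
  refine ⟨channel_comp h1 h4, V' ≫ U', channel_comp hV' hU', ?_, ?_⟩
  · simp [reassoc_of% h5, h2]
  · simp [reassoc_of% h3, h6]

theorem isNormState_comp_channel {A B : Sys} (hT : T.IsSharpWithPurification) {ρ : 𝟙_ Sys ⟶ A}
    (hρ : T.IsNormState ρ) {f : A ⟶ B} (hf : T.IsChannel f) : T.IsNormState (ρ ≫ f) := by
  rw [isNormState_iff hT] at hρ ⊢
  rw [pair_comp, channel_comp_discard hT hf, hρ]

/-- Every system has an internal state invariant under all reversible channels. -/
theorem exists_invariant_state (hT : T.IsSharpWithPurification) (A : Sys) :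
    ∃ χ : 𝟙_ Sys ⟶ A, T.IsNormState χ ∧ T.IsInternal χ ∧
      ∀ U : A ⟶ A, T.IsReversible U → χ ≫ U = χ := by
  obtain ⟨ω, hω, l, hl0, hl1, hl⟩ := exists_orderUnit (convex_normStates hT A)
    (nonempty_normStates hT A) (normStates_subset_Icc hT A)
    (T.finiteDimensional_span_normStates A) (discard hT A) (by
      rintro _ ⟨ρ, hρ, rfl⟩
      exact (isNormState_iff hT ρ).1 hρ)
  have hl1' : 1 - l ≠ 0 := by linarith
  let K : Set ((A ⟶ 𝟙_ Sys) → ℝ) :=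
    {x | x ∈ T.normStates A ∧ ∀ y ∈ T.normStates A, ∃ z ∈ T.normStates A, x = l • y + (1 - l) • z}
  have hclosed : K = T.normStates A ∩ ⋂ y ∈ T.normStates A,
      (fun x => (1 - l)⁻¹ • (x - l • y)) ⁻¹' T.normStates A := by
    ext x
    simp only [K, Set.mem_ofPred_eq, Set.mem_inter_iff, Set.mem_iInter, Set.mem_preimage]
    refine and_congr_right fun _ => forall₂_congr fun y _ => ⟨?_, fun h => ⟨_, h, ?_⟩⟩
    · rintro ⟨z, hz, rfl⟩
      rwa [add_sub_cancel_left, smul_smul, inv_mul_cancel₀ hl1', one_smul]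
    · rw [smul_smul, mul_inv_cancel₀ hl1', one_smul, add_sub_cancel]
  have hKc : IsCompact K := by
    rw [hclosed]
    refine (isCompact_normStates hT A).inter_right (isClosed_biInter fun y _ => ?_)
    refine (isCompact_normStates hT A).isClosed.preimage ?_
    fun_prop
  have hKconv : Convex ℝ K := by
    intro x hx x' hx' a b ha hb hab
    refine ⟨convex_normStates hT A hx.1 hx'.1 ha hb hab, fun y hy => ?_⟩
    obtain ⟨z, hz, h1⟩ := hx.2 y hy
    obtain ⟨z', hz', h2⟩ := hx'.2 y hy
    refine ⟨a • z + b • z', convex_normStates hT A hz hz' ha hb hab, ?_⟩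
    have h3 : l • y = a • (l • y) + b • (l • y) := by rw [← add_smul, hab, one_smul]
    rw [h3]
    conv_lhs => rw [h1, h2]
    simp only [smul_add, smul_smul, mul_comm]
    abel
  have hcomp : ∀ U : A ⟶ A, T.IsReversible U → ∀ x ∈ T.normStates A,
      (x ∘ fun e => U ≫ e) ∈ T.normStates A := by
    rintro U hU _ ⟨ρ, hρ, rfl⟩
    refine ⟨ρ ≫ U, isNormState_comp_channel hT hρ hU.1, funext fun e => ?_⟩
    exact T.pair_comp U ρ e
  have hne : Nonempty {U : A ⟶ A // T.IsReversible U} :=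
    ⟨𝟙 A, T.channel_id A, 𝟙 A, T.channel_id A, by simp, by simp⟩
  obtain ⟨x, ⟨⟨χ, hχ, rfl⟩, hint⟩, hinv⟩ := exists_fixedPoint hKc hKconv ⟨ω, hω, hl⟩
    (fun x hx => hx.1) (normStates_subset_Icc hT A) (T.finiteDimensional_span_normStates A)
    (G := {U : A ⟶ A // T.IsReversible U}) (fun U e => U.1 ≫ e) (by
      rintro ⟨U, hU⟩ x hx
      refine ⟨hcomp U hU x hx.1, fun y hy => ?_⟩
      obtain ⟨V, hV, h1, h2⟩ := hU.exists_inverse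
      obtain ⟨z, hz, h3⟩ := hx.2 _ (hcomp V hV y hy)
      refine ⟨_, hcomp U hU z hz, ?_⟩
      funext e
      simp only [Function.comp_apply, h3, Pi.add_apply, Pi.smul_apply]
      rw [← Category.assoc, h2, Category.id_comp])
    (by
      rintro ⟨U, hU⟩ ⟨V, hV⟩
      exact ⟨⟨U ≫ V, hU.comp hV⟩, funext fun e => by simp⟩)
    (by
      rintro ⟨U, hU⟩
      obtain ⟨V, hV, h1, h2⟩ := hU.exists_inverse
      exact ⟨⟨V, hV⟩, fun e => by simp [reassoc_of% h1]⟩)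
  refine ⟨χ, hχ, ⟨l, hl0, fun ρ hρ => ?_⟩, fun U hU => ?_⟩
  · obtain ⟨_, ⟨σ, hσ, rfl⟩, h⟩ := hint _ ⟨ρ, hρ, rfl⟩
    obtain ⟨s, hs⟩ := T.exists_scalar (c := 1 - l) (by linarith) (by linarith)
    refine ⟨s ≫ σ, fun a => ?_⟩
    rw [T.pair_scalar, hs]
    exact congrFun h a
  · apply T.state_ext
    intro e
    rw [pair_comp]
    exact congrFun (hinv ⟨U, hU⟩) e

/-! ### Weights of pure states -/

/-- If no normalised pure state has a weight in `τ` larger than the probability of `a` on `τ`, where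
`a` is a pure effect with `(a|α) = 1`, then `α` has that weight in `τ`.  Any purification of `τ`
steers to `α` and to a pure state of the purifying system by two pure effects. -/
theorem exists_weight {A B : Sys} {Ψ : 𝟙_ Sys ⟶ A ⊗ B} (hΨ : T.IsPure Ψ)
    {α : 𝟙_ Sys ⟶ A} {a : A ⟶ 𝟙_ Sys} (ha : T.IsPure a)
    (haα : T.pair a α = 1) {q : ℝ} (hq : T.pair a (condR (discard hT B) Ψ) = q) (hq0 : 0 < q)
    (hmax : ∀ γ : 𝟙_ Sys ⟶ A, T.IsPure γ → T.pair (discard hT A) γ = 1 → ∀ r,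
      T.HasWeight r γ (condR (discard hT B) Ψ) → r ≤ q) :
    ∃ (b : B ⟶ 𝟙_ Sys) (β : 𝟙_ Sys ⟶ B), T.IsPure b ∧ T.pair b β = 1 ∧
      (∀ e, T.pair e (condL a Ψ) = q * T.pair e β) ∧
      (∀ e, T.pair e (condR b Ψ) = q * T.pair e α) ∧
      T.HasWeight q α (condR (discard hT B) Ψ) := by
  have hq1 : q ≤ 1 := by
    rw [← hq]
    exact (pair_le_discard hT _ _).trans (discard_le_one hT _)
  obtain ⟨β, hβn, hβ⟩ := exists_normalized hT (condL a Ψ)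
  rw [← pair_condR_eq, hq] at hβ
  have hβP : T.IsPure β := (isPure_condL hT ha hΨ).of_smul hq0 hq1 hβ
  obtain ⟨b, hb, hbβ⟩ := exists_dagger hT hβP hβn
  obtain ⟨γ, hγn, hγ⟩ := exists_normalized hT (condR b Ψ)
  set r := T.pair (discard hT A) (condR b Ψ) with hr
  have h1 : q = r * T.pair a γ := by
    rw [← hγ, pair_condR_eq, hβ, hbβ, mul_one]
  have hqr : q ≤ r := by
    rw [h1]
    exact mul_le_of_le_one_right (T.pair_nonneg _ _)
      ((pair_le_discard hT a γ).trans (discard_le_one hT γ))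
  have hr1 : r ≤ 1 := discard_le_one hT _
  have hr0 : 0 < r := hq0.trans_le hqr
  have hγP : T.IsPure γ := (isPure_condR hT hb hΨ).of_smul hr0 hr1 hγ
  obtain ⟨b', hb'⟩ := exists_compl hT b
  have hw : T.HasWeight r γ (condR (discard hT B) Ψ) := by
    refine ⟨condR b' Ψ, fun e => ?_⟩
    rw [← hγ, pair_condR_eq, pair_condR_eq, pair_condR_eq, hb']
  have hrq : r = q := le_antisymm (hmax γ hγP hγn r hw) hqr
  have h2 : T.pair a γ = 1 := by
    rw [hrq] at h1
    exact mul_left_cancel₀ hq0.ne' (by linarith)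
  have h3 : γ = α := eq_of_pair_eq_one ha h2 haα hT
  subst h3
  rw [hrq] at hγ hw
  exact ⟨b, β, hb, hbβ, hβ, hγ, hw⟩

/-- The invariant state contains all normalised pure states with the same largest weight, which is
also the probability of every pure effect that occurs with certainty on some state. -/
theorem exists_common_weight {A : Sys} {χ : 𝟙_ Sys ⟶ A} (hχ : T.IsNormState χ)
    (hint : T.IsInternal χ) (hinv : ∀ U : A ⟶ A, T.IsReversible U → χ ≫ U = χ) :
    ∃ p : ℝ, 0 < p ∧ p ≤ 1 ∧
      (∀ (α : 𝟙_ Sys ⟶ A) (a : A ⟶ 𝟙_ Sys), T.IsPure a → T.pair a α = 1 → T.pair a χ = p) ∧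
      (∀ γ : 𝟙_ Sys ⟶ A, T.IsPure γ → T.pair (discard hT A) γ = 1 →
        T.HasWeight p γ χ ∧ ∀ r, T.HasWeight r γ χ → r ≤ p) := by
  obtain ⟨l, hl0, hl⟩ := hint
  -- weights are carried from one pure state to another by reversible channels
  have htrans : ∀ γ γ' : 𝟙_ Sys ⟶ A, T.IsPure γ → T.pair (discard hT A) γ = 1 → T.IsPure γ' →
      T.pair (discard hT A) γ' = 1 → ∀ r, T.HasWeight r γ χ → T.HasWeight r γ' χ := by
    rintro γ γ' hγ hγn hγ' hγn' r ⟨ν, hν⟩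
    obtain ⟨U, hU, rfl⟩ := exists_reversible hT hγ hγ' hγn hγn'
    refine ⟨ν ≫ U, fun a => ?_⟩
    rw [← hinv U hU, pair_comp, pair_comp, pair_comp, hν]
  have hn : ∀ (α : 𝟙_ Sys ⟶ A) (a : A ⟶ 𝟙_ Sys), T.pair a α = 1 → T.pair (discard hT A) α = 1 :=
    fun α a h => le_antisymm (discard_le_one hT α) (h ▸ pair_le_discard hT a α)
  have hbound : ∀ (α : 𝟙_ Sys ⟶ A) (a : A ⟶ 𝟙_ Sys), T.IsPure a → T.pair a α = 1 →
      ∀ γ : 𝟙_ Sys ⟶ A, T.IsPure γ → T.pair (discard hT A) γ = 1 → ∀ r, T.HasWeight r γ χ →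
      r ≤ T.pair a χ := by
    intro α a ha haα γ hγ hγn r hr
    have := (htrans γ α hγ hγn (isPure_of_pair_eq_one ha haα hT) (hn α a haα) r hr).le a
    rwa [haα, mul_one] at this
  obtain ⟨B, Ψ, -, hΨ, hm⟩ := exists_purification hT ((isNormState_iff hT χ).1 hχ)
  have hweight : ∀ (α : 𝟙_ Sys ⟶ A) (a : A ⟶ 𝟙_ Sys), T.IsPure a → T.pair a α = 1 →
      T.HasWeight (T.pair a χ) α χ := by
    intro α a ha haα
    have hpos : 0 < T.pair a χ := by
      have := (hl α ((isNormState_iff hT α).2 (hn α a haα))).le a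
      rw [haα, mul_one] at this
      exact hl0.trans_le this
    obtain ⟨-, -, -, -, -, -, h⟩ := exists_weight hT hΨ ha haα (by rw [hm]) hpos (by
      rw [hm]
      exact hbound α a ha haα)
    rwa [hm] at h
  obtain ⟨α₀, hα₀, hα₀n⟩ := exists_pure_state A hT
  obtain ⟨a₀, ha₀, haα₀⟩ := exists_dagger hT hα₀ hα₀n
  refine ⟨T.pair a₀ χ, ?_, ?_, fun α a ha haα => ?_, fun γ hγ hγn => ⟨?_, ?_⟩⟩
  · have := (hl α₀ ((isNormState_iff hT α₀).2 hα₀n)).le a₀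
    rw [haα₀, mul_one] at this
    exact hl0.trans_le this
  · exact (pair_le_discard hT _ _).trans (discard_le_one hT _)
  · have hα := isPure_of_pair_eq_one ha haα hT
    exact le_antisymm
      (hbound α₀ a₀ ha₀ haα₀ α hα (hn α a haα) _ (hweight α a ha haα))
      (hbound α a ha haα α₀ hα₀ hα₀n _ (hweight α₀ a₀ ha₀ haα₀))
  · exact htrans α₀ γ hα₀ hα₀n hγ hγn _ (hweight α₀ a₀ ha₀ haα₀)
  · exact hbound α₀ a₀ ha₀ haα₀ γ hγ hγn

/-- A system with two distinct normalised states has a pure effect that occurs with certainty on one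
normalised state and never on another one. -/
theorem exists_distinguishable {A : Sys} {ρ σ : 𝟙_ Sys ⟶ A} (hρ : T.IsNormState ρ)
    (hσ : T.IsNormState σ) (hne : ρ ≠ σ) :
    ∃ (a : A ⟶ 𝟙_ Sys) (α τ : 𝟙_ Sys ⟶ A), T.IsPure a ∧ T.pair a α = 1 ∧ T.pair a τ = 0 ∧
      T.pair (discard hT A) α = 1 ∧ T.pair (discard hT A) τ = 1 := by
  obtain ⟨χ, hχ, hint, hinv⟩ := exists_invariant_state hT A
  obtain ⟨p, hp0, hp1, hp, hpw⟩ := exists_common_weight hT hχ hint hinv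
  obtain ⟨α, hα, hαn⟩ := exists_pure_state A hT
  obtain ⟨a, ha, haα⟩ := exists_dagger hT hα hαn
  obtain ⟨ν, hν⟩ := (hpw α hα hαn).1
  obtain ⟨τ, hτn, hτ⟩ := exists_normalized hT ν
  rw [isNormState_iff hT] at hχ
  have h1 := hν (discard hT A)
  rw [hχ, hαn, mul_one] at h1
  have h2 := hν a
  rw [hp α a ha haα, haα, mul_one] at h2
  have h3 : T.pair a ν = 0 := by linarith
  rcases hp1.lt_or_eq with hlt | heq
  · refine ⟨a, α, τ, ha, haα, ?_, hαn, hτn⟩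
    rw [hτ] at h3
    rcases mul_eq_zero.1 h3 with h4 | h4
    · linarith
    · exact h4
  · -- otherwise the invariant state is pure, and as it is internal there is no other one
    exfalso
    have h4 : T.pair (discard hT A) ν = 0 := by linarith
    have h5 : χ = α := T.state_ext fun e => by
      rw [hν, heq, eq_of_discard_eq_zero hT h4]; ring
    obtain ⟨l, hl0, hl⟩ := hint
    have h6 : ∀ ω : 𝟙_ Sys ⟶ A, T.IsNormState ω → ω = χ := by
      intro ω hω
      obtain ⟨ν', hν'⟩ := hl ω hω
      rw [isNormState_iff hT] at hω
      obtain ⟨σ', -, hσ'⟩ := exists_normalized hT ν'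
      have h7 := hν' (discard hT A)
      rw [hχ, hω, mul_one] at h7
      have h8 := T.pair_nonneg (discard hT A) ν'
      refine (h5 ▸ hα : T.IsPure χ).eq_of_mix hT hχ hω hl0 (by linarith) (σ := σ') fun e => ?_
      rw [hν' e, hσ' e, show T.pair (discard hT A) ν' = 1 - l by linarith]
    exact hne ((h6 ρ hρ).trans (h6 σ hσ).symm)

/-! ### Steering -/

/-- Some system has two normalised states perfectly distinguished by a pure effect. -/
def HasBit (T : OPT Sys) : Prop :=
  ∃ (X : Sys) (x : X ⟶ 𝟙_ Sys) (ξ₀ ξ₁ : 𝟙_ Sys ⟶ X), T.IsPure x ∧ T.pair x ξ₀ = 1 ∧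
    T.pair x ξ₁ = 0 ∧ T.IsNormState ξ₀ ∧ T.IsNormState ξ₁

omit [SymmetricCategory Sys] in
theorem condR_associator {A X E : Sys} (x : X ⟶ 𝟙_ Sys) (e : E ⟶ 𝟙_ Sys)
    (Θ : 𝟙_ Sys ⟶ (A ⊗ X) ⊗ E) :
    condR (x ▷ E ≫ (λ_ E).hom ≫ e) (Θ ≫ (α_ A X E).hom) = condR x (condR e Θ) := by
  have h1 : x ▷ E ≫ (λ_ E).hom ≫ e = X ◁ e ≫ (ρ_ X).hom ≫ x := by
    rw [← leftUnitor_naturality, ← rightUnitor_naturality, whisker_exchange_assoc, unitors_equal]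
  rw [h1]
  simp [condR]

/-- Steering: a decomposition of the marginal of a pure state `Ψ` of `A ⊗ B` is induced by an effect
on `B`, which moreover can be taken to be a pure transformation followed by discarding.  The
decomposition is recorded in a bit `X` correlated with `A`; purifying this and comparing with `Ψ`
gives a pure transformation from `B` to `X` and a further system, followed by a pure effect on
`X`. -/
theorem exists_steering (hbit : T.HasBit) {A B : Sys} {Ψ : 𝟙_ Sys ⟶ A ⊗ B} (hΨ : T.IsPure Ψ)
    (hn : T.pair (discard hT (A ⊗ B)) Ψ = 1) {ρ₁ ρ₂ : 𝟙_ Sys ⟶ A}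
    (h : ∀ a, T.pair a (condR (discard hT B) Ψ) = T.pair a ρ₁ + T.pair a ρ₂) :
    ∃ (E : Sys) (K : B ⟶ E), T.IsPure K ∧ condR (K ≫ discard hT E) Ψ = ρ₁ := by
  obtain ⟨X, x, ξ₀, ξ₁, hx, hx0, hx1, hξ₀, hξ₁⟩ := hbit
  rw [isNormState_iff hT] at hξ₀ hξ₁
  have hd0 : ξ₀ ≫ discard hT X = 𝟙 _ := T.scalar_eq_id hξ₀
  have hd1 : ξ₁ ≫ discard hT X = 𝟙 _ := T.scalar_eq_id hξ₁
  have hx0' : ξ₀ ≫ x = 𝟙 _ := T.scalar_eq_id hx0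
  obtain ⟨σ₁, hσ₁n, hσ₁⟩ := exists_normalized hT ρ₁
  obtain ⟨σ₂, hσ₂n, hσ₂⟩ := exists_normalized hT ρ₂
  set c := T.pair (discard hT A) ρ₁ with hc
  have hc2 : T.pair (discard hT A) ρ₂ = 1 - c := by
    have h1 := h (discard hT A)
    rw [pair_discard_condR, hn] at h1
    linarith
  rw [hc2] at hσ₂
  have hc0 : 0 ≤ c := T.pair_nonneg _ _
  have hc1 : c ≤ 1 := discard_le_one hT _
  obtain ⟨Γ, hΓ⟩ := exists_mix (T := T) hc0 hc1 (prodState σ₁ ξ₀) (prodState σ₂ ξ₁)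
  -- the marginals of the correlated state `Γ`
  have hcond : ∀ (y : X ⟶ 𝟙_ Sys) (e : A ⟶ 𝟙_ Sys), T.pair e (condR y Γ) =
      c * T.pair e (condR y (prodState σ₁ ξ₀)) + (1 - c) * T.pair e (condR y (prodState σ₂ ξ₁)) :=
    fun y e => by
      simp only [condR, pair_comp T (A ◁ y ≫ _), hΓ]
  have hΓd : condR (discard hT X) Γ = condR (discard hT B) Ψ := T.state_ext fun e => by
    rw [hcond, condR_prodState, condR_prodState, hd0, hd1, Category.id_comp, Category.id_comp, h,
      hσ₁ e, hσ₂ e]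
  have hΓx : condR x Γ = ρ₁ := T.state_ext fun e => by
    rw [hcond, condR_prodState, condR_prodState, hx0', Category.id_comp, T.pair_scalar,
      show T.prob (ξ₁ ≫ x) = 0 from hx1, hσ₁ e]
    ring
  have hΓn : T.pair (discard hT (A ⊗ X)) Γ = 1 := by
    rw [← pair_discard_condR, hΓd, pair_discard_condR, hn]
  obtain ⟨E, Θ, -, hΘ, hΘm⟩ := exists_purification hT hΓn
  have hXE : discard hT (X ⊗ E) = discard hT X ▷ E ≫ (λ_ E).hom ≫ discard hT E :=
    (whiskerRight_discard hT X E).symm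
  obtain ⟨K, hK, hΨK⟩ := exists_pure_comp_purification hT hΨ
    (isPure_comp hT hΘ (isPure_associator_hom hT A X E)) hn (by
      rw [hXE, condR_associator, hΘm, hΓd])
  refine ⟨E, K ≫ x ▷ E ≫ (λ_ E).hom, isPure_comp hT hK (isPure_comp hT
    (isPure_whiskerRight hT hx E) (isPure_leftUnitor_hom hT E)), ?_⟩
  rw [Category.assoc, Category.assoc, ← condR_whiskerLeft, ← hΨK, condR_associator,
    hΘm, hΓx]

theorem exists_steering_effect (hbit : T.HasBit) {A B : Sys} {Ψ : 𝟙_ Sys ⟶ A ⊗ B}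
    (hΨ : T.IsPure Ψ) (hn : T.pair (discard hT (A ⊗ B)) Ψ = 1) {ρ : 𝟙_ Sys ⟶ A} {l : ℝ}
    (hρ : T.IsNormState ρ) (hl : 0 ≤ l) (h : T.HasWeight l ρ (condR (discard hT B) Ψ)) :
    ∃ b : B ⟶ 𝟙_ Sys, ∀ a, T.pair a (condR b Ψ) = l * T.pair a ρ := by
  have hl1 := h.le (discard hT A)
  rw [(isNormState_iff hT ρ).1 hρ, pair_discard_condR, hn, mul_one] at hl1
  obtain ⟨s, hs⟩ := T.exists_scalar hl hl1
  obtain ⟨ν, hν⟩ := h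
  obtain ⟨E, K, -, hK⟩ := exists_steering hT hbit hΨ hn (ρ₁ := s ≫ ρ) (ρ₂ := ν) (fun a => by
    rw [T.pair_scalar, hs, hν])
  exact ⟨_, fun a => by rw [hK, T.pair_scalar, hs]⟩

/-- The purification of an internal state is faithful: it separates effects. -/
theorem effect_ext_of_condL (hbit : T.HasBit) {A B : Sys} {Φ : 𝟙_ Sys ⟶ A ⊗ B}
    (hΦ : T.IsPure Φ) (hn : T.pair (discard hT (A ⊗ B)) Φ = 1)
    (hint : T.IsInternal (condR (discard hT B) Φ)) {e e' : A ⟶ 𝟙_ Sys}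
    (h : condL e Φ = condL e' Φ) : e = e' := by
  obtain ⟨l, hl0, hl⟩ := hint
  apply T.effect_ext
  intro ρ
  obtain ⟨σ, hσn, hσ⟩ := exists_normalized hT ρ
  have hσn' := (isNormState_iff hT σ).2 hσn
  obtain ⟨f, hf⟩ := exists_steering_effect hT hbit hΦ hn hσn' hl0.le (hl σ hσn')
  have h1 : l * T.pair e σ = l * T.pair e' σ := by
    rw [← hf, ← hf, pair_condR_eq, pair_condR_eq, h]
  rw [hσ e, hσ e', mul_left_cancel₀ hl0.ne' h1]

/-- Every effect is a pure transformation followed by discarding. -/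
theorem exists_pure_comp_discard (hbit : T.HasBit) {A : Sys} (a : A ⟶ 𝟙_ Sys) :
    ∃ (E : Sys) (K : A ⟶ E), T.IsPure K ∧ K ≫ discard hT E = a := by
  obtain ⟨χ, hχ, hint, -⟩ := exists_invariant_state hT A
  obtain ⟨B, Φ, hn, hΦ, rfl⟩ := exists_purification hT ((isNormState_iff hT χ).1 hχ)
  obtain ⟨b, hb⟩ := exists_compl hT a
  obtain ⟨E, K, hK, h⟩ := exists_steering hT hbit (isPure_comp hT hΦ (isPure_swap hT A B))
    (ρ₁ := condL a Φ) (ρ₂ := condL b Φ) (by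
      rw [← pair_discard_condR, condR_braiding, pair_discard_condL, hn]) (fun e => by
      rw [condR_braiding, ← pair_condR_eq, ← pair_condR_eq, ← pair_condR_eq, hb])
  rw [condR_braiding] at h
  exact ⟨E, K, hK, effect_ext_of_condL hT hbit hΦ hn hint h⟩

/-- A measurement of the effect `a` that is as gentle as possible: a pure transformation `F`, whose
probability is bounded by the one of `a`, that leaves undisturbed all states on which `a` occurs
with certainty.  It is enough to fix the purification of an internal point of the face formed
by these states. -/
theorem exists_gentle (hbit : T.HasBit) {A : Sys} (a : A ⟶ 𝟙_ Sys) :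
    ∃ F : A ⟶ A, T.IsPure F ∧ (∀ ρ, T.pair (discard hT A) (ρ ≫ F) ≤ T.pair a ρ) ∧
      ∀ ρ, T.pair a ρ = T.pair (discard hT A) ρ → ρ ≫ F = ρ := by
  obtain ⟨E, K, hK, hKa⟩ := exists_pure_comp_discard hT hbit a
  have hle : ∀ (L : E ⟶ A) (ρ : 𝟙_ Sys ⟶ A),
      T.pair (discard hT A) (ρ ≫ K ≫ L) ≤ T.pair a ρ := by
    intro L ρ
    rw [← Category.assoc, ← hKa, ← pair_comp]
    exact discard_comp_le hT L (ρ ≫ K)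
  -- it is enough to consider normalised states
  suffices hL : ∃ L : E ⟶ A, T.IsPure L ∧ ∀ ρ, T.pair (discard hT A) ρ = 1 → T.pair a ρ = 1 →
      ρ ≫ K ≫ L = ρ by
    obtain ⟨L, hL, hfix⟩ := hL
    refine ⟨K ≫ L, isPure_comp hT hK hL, hle L, fun ρ hρ => ?_⟩
    obtain ⟨σ, hσn, hσ⟩ := exists_normalized hT ρ
    apply T.state_ext
    intro e
    rw [pair_comp, hσ, hσ e]
    rcases (T.pair_nonneg (discard hT A) ρ).eq_or_lt with h0 | h0
    · rw [← h0]; simp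
    · rw [hσ a] at hρ
      rw [← pair_comp, hfix σ hσn]
      exact mul_left_cancel₀ h0.ne' (by rw [hρ, mul_one])
  let S : Set ((A ⟶ 𝟙_ Sys) → ℝ) := {x | x ∈ T.normStates A ∧ x a = 1}
  by_cases hne : S.Nonempty
  · have hSconv : Convex ℝ S := by
      intro x hx y hy c d hc hd hcd
      refine ⟨convex_normStates hT A hx.1 hy.1 hc hd hcd, ?_⟩
      simp [hx.2, hy.2, hcd]
    have hSfd : FiniteDimensional ℝ (Submodule.span ℝ S) := by
      have := T.finiteDimensional_span_normStates A
      exact Submodule.finiteDimensional_of_le (Submodule.span_mono fun x hx => hx.1)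
    obtain ⟨_, ⟨⟨ω, hω, rfl⟩, hωa⟩, l, hl0, hl1, hl⟩ := exists_orderUnit hSconv hne
      (fun x hx => normStates_subset_Icc hT A x hx.1) hSfd (discard hT A) (by
        rintro _ ⟨⟨ρ, hρ, rfl⟩, -⟩
        exact (isNormState_iff hT ρ).1 hρ)
    obtain ⟨C, Ψ, hn, hΨ, hm⟩ := exists_purification hT ((isNormState_iff hT ω).1 hω)
    have hωa' : T.pair a ω = 1 := hωa
    have hCmarg : condL (discard hT E) (Ψ ≫ K ▷ C) = condL (discard hT A) Ψ := by
      rw [condL_whiskerRight, hKa]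
      exact condL_eq_of_pair_eq_one hT hn (by rw [hm, hωa'])
    obtain ⟨L, hL, hΨL⟩ := exists_pure_comp_purification hT
      (Ψ := (Ψ ≫ K ▷ C) ≫ (β_ E C).hom) (Ψ' := Ψ ≫ (β_ A C).hom)
      (isPure_comp hT (isPure_comp hT hΨ (isPure_whiskerRight hT hK C)) (isPure_swap hT E C))
      (isPure_comp hT hΨ (isPure_swap hT A C))
      (by rw [← pair_discard_condR, condR_braiding, hCmarg, pair_discard_condL, hn])
      (by rw [condR_braiding, condR_braiding, hCmarg])
    rw [Category.assoc, Category.assoc, ← BraidedCategory.braiding_naturality_left,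
      ← Category.assoc, ← Category.assoc, cancel_mono, Category.assoc, ← comp_whiskerRight] at hΨL
    refine ⟨L, hL, fun ρ hρn hρa => ?_⟩
    obtain ⟨_, ⟨⟨σ, -, rfl⟩, -⟩, hσ⟩ := hl _
      ⟨⟨ρ, (isNormState_iff hT ρ).2 hρn, rfl⟩, hρa⟩
    obtain ⟨s, hs⟩ := T.exists_scalar (c := 1 - l) (by linarith) (by linarith)
    obtain ⟨f, hf⟩ := exists_steering_effect hT hbit hΨ hn ((isNormState_iff hT ρ).2 hρn) hl0.le
      ⟨s ≫ σ, fun e => by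
        rw [hm, T.pair_scalar, hs]
        exact congrFun hσ e⟩
    apply T.state_ext
    intro e
    have h1 : l * T.pair e (ρ ≫ K ≫ L) = l * T.pair e ρ := by
      rw [pair_comp, ← hf, ← pair_comp, ← condR_whiskerRight, ← hΨL, hf]
    exact mul_left_cancel₀ hl0.ne' h1
  · obtain ⟨b, hb, -⟩ := hT.pureSharpness E
    obtain ⟨α, hα, -⟩ := exists_pure_state A hT
    refine ⟨b ≫ α, isPure_comp hT hb hα, fun ρ hρn hρa => absurd ?_ hne⟩
    exact ⟨T.stVec ρ, ⟨ρ, (isNormState_iff hT ρ).2 hρn, rfl⟩, hρa⟩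

/-! ### Uniqueness of the dagger -/

/-- A pure effect is determined by the normalised state on which it occurs with certainty. -/
theorem pure_effect_unique (hT : T.IsSharpWithPurification) (hbit : T.HasBit) {A : Sys}
    {α : 𝟙_ Sys ⟶ A} {a a' : A ⟶ 𝟙_ Sys}
    (ha : T.IsPure a) (ha' : T.IsPure a') (h : T.pair a α = 1) (h' : T.pair a' α = 1) :
    a = a' := by
  obtain ⟨χ, hχ, hint, hinv⟩ := exists_invariant_state hT A
  obtain ⟨p, hp0, hp1, hp, hpw⟩ := exists_common_weight hT hχ hint hinv
  obtain ⟨B, Φ, hn, hΦ, rfl⟩ := exists_purification hT ((isNormState_iff hT χ).1 hχ)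
  obtain ⟨b, β, hb, hbβ, haβ, hbα, -⟩ := exists_weight hT hΦ ha h (hp α a ha h) hp0
    fun γ hγ hγn => (hpw γ hγ hγn).2
  apply effect_ext_of_condL hT hbit hΦ hn hint
  obtain ⟨β', -, hβ'⟩ := exists_normalized hT (condL a' Φ)
  rw [← pair_condR_eq, hp α a' ha' h'] at hβ'
  have h1 : T.pair b β' = 1 := by
    have h2 := hβ' b
    rw [← pair_condR_eq, hbα, h'] at h2
    exact (mul_left_cancel₀ hp0.ne' h2).symm
  rw [← eq_of_pair_eq_one hb hbβ h1 hT] at hβ'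
  exact T.state_ext fun e => by rw [haβ, hβ']

/-- The pure effect of a pure state is the smallest effect that occurs on it with certainty. -/
theorem pure_effect_le (hT : T.IsSharpWithPurification) (hbit : T.HasBit) {A : Sys}
    {α : 𝟙_ Sys ⟶ A} {a b : A ⟶ 𝟙_ Sys}
    (ha : T.IsPure a) (h : T.pair a α = 1) (hb : T.pair b α = 1) (ρ : 𝟙_ Sys ⟶ A) :
    T.pair a ρ ≤ T.pair b ρ := by
  obtain ⟨F, hF, hFle, hFfix⟩ := exists_gentle hT hbit b
  have hα : T.pair (discard hT A) α = 1 :=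
    le_antisymm (discard_le_one hT α) (h ▸ pair_le_discard hT a α)
  have h1 : F ≫ a = a := by
    refine pure_effect_unique hT hbit (isPure_comp hT hF ha) ha (α := α) ?_ h
    rw [← pair_comp, hFfix α (by rw [hb, hα]), h]
  rw [← h1, ← pair_comp]
  exact (pair_le_discard hT a _).trans (hFle ρ)

/-! ### Pure maximal sets -/

/-- The invariant state is a sum of orthogonal pure states, all with the common weight, and of a
residual state. -/
theorem exists_residual {A : Sys} {χ : 𝟙_ Sys ⟶ A} (hχ : T.IsNormState χ) {p : ℝ} (hp0 : 0 < p)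
    (hp : ∀ (α : 𝟙_ Sys ⟶ A) (a : A ⟶ 𝟙_ Sys), T.IsPure a → T.pair a α = 1 → T.pair a χ = p)
    (hpw : ∀ γ : 𝟙_ Sys ⟶ A, T.IsPure γ → T.pair (discard hT A) γ = 1 →
      ∀ r, T.HasWeight r γ χ → r ≤ p) {ι : Type*} {α : ι → (𝟙_ Sys ⟶ A)}
    {a : ι → (A ⟶ 𝟙_ Sys)} (ha : ∀ i, T.IsPure (a i)) (haα : ∀ i, T.pair (a i) (α i) = 1)
    (horth : ∀ i j, i ≠ j → T.pair (a i) (α j) = 0) (I : Finset ι) :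
    ∃ ν : 𝟙_ Sys ⟶ A, ∀ e, T.pair e χ = ∑ i ∈ I, p * T.pair e (α i) + T.pair e ν := by
  classical
  induction I using Finset.induction_on with
  | empty => exact ⟨χ, by simp⟩
  | insert k I hk ih =>
    obtain ⟨ν, hν⟩ := ih
    rw [isNormState_iff hT] at hχ
    have hkν : T.pair (a k) ν = p := by
      have h1 := hν (a k)
      rw [hp _ _ (ha k) (haα k), Finset.sum_eq_zero fun i hi => by
        rw [horth k i (by rintro rfl; exact hk hi), mul_zero]] at h1
      linarith
    obtain ⟨τ, hτn, hτ⟩ := exists_normalized hT ν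
    set t := T.pair (discard hT A) ν with ht
    have htp : p ≤ t := hkν ▸ pair_le_discard hT (a k) ν
    have ht0 : 0 < t := hp0.trans_le htp
    have hq : t * T.pair (a k) τ = p := by rw [← hτ, hkν]
    have hq0 : 0 < T.pair (a k) τ := by
      by_contra h
      nlinarith [T.pair_nonneg (a k) τ]
    -- a weight in the normalised residual state is a weight in the invariant state
    have hmax : ∀ γ : 𝟙_ Sys ⟶ A, T.IsPure γ → T.pair (discard hT A) γ = 1 → ∀ r,
        T.HasWeight r γ τ → r ≤ T.pair (a k) τ := by
      rintro γ hγ hγn r ⟨ν', hν'⟩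
      have h1 := hν (discard hT A)
      rw [hχ] at h1
      obtain ⟨κ, hκ⟩ := exists_finset_sum hT I (fun _ => p) α (fun _ _ => hp0.le) (by linarith)
      by_cases hr : r < 0
      · linarith
      obtain ⟨κ', hκ'⟩ := exists_add hT zero_le_one ht0.le κ ν' (by
        have h2 := hν' (discard hT A)
        rw [hτn, hγn, mul_one] at h2
        rw [hκ]
        nlinarith)
      have h3 := hpw γ hγ hγn (t * r) ⟨κ', fun e => by
        rw [hκ', hκ, hν, hτ, hν']; ring⟩
      rw [← hq] at h3
      exact le_of_mul_le_mul_left h3 ht0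
    obtain ⟨B, Ψ, -, hΨ, hm⟩ := exists_purification hT hτn
    obtain ⟨-, -, -, -, -, -, ν', hν'⟩ := exists_weight hT hΨ (ha k) (haα k) (by rw [hm]) hq0 (by
      rwa [hm])
    obtain ⟨s, hs⟩ := T.exists_scalar ht0.le (discard_le_one hT ν)
    refine ⟨s ≫ ν', fun e => ?_⟩
    rw [hm] at hν'
    rw [Finset.sum_insert hk, T.pair_scalar, hs, hν, hτ, hν', ← hq]
    ring

/-- An effect that occurs with certainty on a state orthogonal to all `α i`, and never on the
`α i`: sort out the `α i` one after the other by gentle measurements. -/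
theorem exists_annihilating_effect (hbit : T.HasBit) {A : Sys} {ι : Type*}
    {α : ι → (𝟙_ Sys ⟶ A)} (hαn : ∀ i, T.pair (discard hT A) (α i) = 1) {a : ι → (A ⟶ 𝟙_ Sys)}
    (haα : ∀ i, T.pair (a i) (α i) = 1) (horth : ∀ i j, i ≠ j → T.pair (a i) (α j) = 0)
    {τ : 𝟙_ Sys ⟶ A} (hτn : T.pair (discard hT A) τ = 1) (hτ : ∀ i, T.pair (a i) τ = 0)
    (I : Finset ι) : ∃ s : A ⟶ 𝟙_ Sys, T.pair s τ = 1 ∧ ∀ i ∈ I, T.pair s (α i) = 0 := by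
  classical
  induction I using Finset.induction_on with
  | empty => exact ⟨discard hT A, hτn, by simp⟩
  | insert k I hk ih =>
    obtain ⟨s, hsτ, hs⟩ := ih
    obtain ⟨b, hb⟩ := exists_compl hT (a k)
    obtain ⟨F, -, hFle, hFfix⟩ := exists_gentle hT hbit b
    have hfix : ∀ ρ, T.pair (a k) ρ = 0 → ρ ≫ F = ρ := fun ρ hρ => hFfix ρ (by
      rw [← hb, hρ, zero_add])
    refine ⟨F ≫ s, by rw [← pair_comp, hfix τ (hτ k), hsτ], fun i hi => ?_⟩
    rw [← pair_comp]
    by_cases hik : i = k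
    · subst hik
      refine eq_of_discard_eq_zero hT (le_antisymm ((hFle _).trans ?_) (T.pair_nonneg _ _)) s
      have := hb (α i)
      rw [haα, hαn] at this
      linarith
    · rw [hfix (α i) (horth k i (Ne.symm hik))]
      exact hs i ((Finset.mem_insert.1 hi).resolve_left hik)

/-- Perfectly distinguishable states remain so when a state is added that an effect separates from
all of them. -/
theorem PerfectlyDistinguishable.option (hbit : T.HasBit) {A : Sys} {d : ℕ}
    {α : Fin d → (𝟙_ Sys ⟶ A)} (hα : T.PerfectlyDistinguishable α)
    {τ : 𝟙_ Sys ⟶ A} (hτn : T.pair (discard hT A) τ = 1)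
    {s : A ⟶ 𝟙_ Sys} (hsτ : T.pair s τ = 1) (hs : ∀ i, T.pair s (α i) = 0) :
    T.PerfectlyDistinguishable (fun o : Option (Fin d) => o.elim τ α) := by
  obtain ⟨b, hb, hb1, hb0⟩ := hα
  obtain ⟨s', hs'⟩ := exists_compl hT s
  obtain ⟨F, -, hFle, hFfix⟩ := exists_gentle hT hbit s'
  obtain ⟨G, hG⟩ := T.exists_binary F
  have hFα : ∀ i, α i ≫ F = α i := fun i => hFfix _ (by rw [← hs', hs, zero_add])
  have hFτ : T.pair (discard hT A) (τ ≫ F) = 0 := by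
    refine le_antisymm ((hFle τ).trans ?_) (T.pair_nonneg _ _)
    have := hs' τ
    rw [hsτ, hτn] at this
    linarith
  have hFG := binary_discard hT hG
  have htest := T.test_reindex _ (T.test_branch F G hG b (fun _ : Unit => discard hT A) hb
    (discard_channel hT A)) (Equiv.optionEquivSumPUnit (Fin d))
  refine ⟨_, htest, ?_, ?_⟩
  · rintro (_ | i)
    · have := hFG τ
      simp only [Equiv.optionEquivSumPUnit_none, Sum.elim_inr, Option.elim_none, ← pair_comp]
      linarith
    · simp only [Equiv.optionEquivSumPUnit_some, Sum.elim_inl, Option.elim_some, ← pair_comp,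
        hFα, hb1]
  · rintro (_ | i) (_ | j) hij
    · exact absurd rfl hij
    · have := hFG (α j)
      simp only [Equiv.optionEquivSumPUnit_none, Sum.elim_inr, Option.elim_some, ← pair_comp]
      rw [hFα] at this
      linarith
    · simp only [Equiv.optionEquivSumPUnit_some, Sum.elim_inl, Option.elim_none, ← pair_comp]
      exact eq_of_discard_eq_zero hT hFτ _
    · simp only [Equiv.optionEquivSumPUnit_some, Sum.elim_inl, Option.elim_some, ← pair_comp, hFα]
      exact hb0 i j fun h => hij (by rw [h])

/-- For a pure maximal set: the daggers are orthogonal and add up to the deterministic effect, and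
the states add up to a multiple of the invariant state. -/
theorem IsPureMaximal.resolution (hbit : T.HasBit) {A : Sys} {d : ℕ} {α : Fin d → (𝟙_ Sys ⟶ A)}
    (hα : T.IsPureMaximal α) {a : Fin d → (A ⟶ 𝟙_ Sys)} (ha : ∀ i, T.IsPure (a i))
    (haα : ∀ i, T.pair (a i) (α i) = 1) :
    (∀ i j, i ≠ j → T.pair (a i) (α j) = 0) ∧
    (∀ ρ, ∑ i, T.pair (a i) ρ = T.pair (discard hT A) ρ) ∧
    ∃ (χ : 𝟙_ Sys ⟶ A) (p : ℝ), T.IsNormState χ ∧ T.IsInternal χ ∧ 0 < p ∧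
      ∀ e, T.pair e χ = ∑ i, p * T.pair e (α i) := by
  obtain ⟨hnp, hdist, hmax⟩ := hα
  have hαn : ∀ i, T.pair (discard hT A) (α i) = 1 := fun i => (isNormState_iff hT _).1 (hnp i).1
  obtain ⟨b, hb, hb1, hb0⟩ := id hdist
  have hle : ∀ i ρ, T.pair (a i) ρ ≤ T.pair (b i) ρ := fun i ρ =>
    pure_effect_le hT hbit (ha i) (haα i) (hb1 i) ρ
  have horth : ∀ i j, i ≠ j → T.pair (a i) (α j) = 0 := fun i j hij =>
    le_antisymm (hb0 i j hij ▸ hle i (α j)) (T.pair_nonneg _ _)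
  have hsum_le : ∀ ρ, ∑ i, T.pair (a i) ρ ≤ T.pair (discard hT A) ρ := fun ρ => by
    rw [← sum_pair_test hT hb]
    exact Finset.sum_le_sum fun i _ => hle i ρ
  obtain ⟨χ, hχ, hint, hinv⟩ := exists_invariant_state hT A
  obtain ⟨p, hp0, hp1, hp, hpw⟩ := exists_common_weight hT hχ hint hinv
  obtain ⟨ν, hν⟩ := exists_residual hT hχ hp0 hp (fun γ h h' => (hpw γ h h').2) ha haα horth
    Finset.univ
  have hν0 : T.pair (discard hT A) ν = 0 := by
    by_contra hne
    obtain ⟨τ, hτn, hτ⟩ := exists_normalized hT ν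
    have haτ : ∀ i, T.pair (a i) τ = 0 := by
      intro i
      have h1 := hν (a i)
      rw [hp _ _ (ha i) (haα i), Finset.sum_eq_single i (fun j _ hj => by
        rw [horth i j hj.symm, mul_zero]) (by simp), haα, mul_one, hτ] at h1
      have h2 : T.pair (discard hT A) ν * T.pair (a i) τ = 0 := by linarith
      exact (mul_eq_zero.1 h2).resolve_left hne
    obtain ⟨s, hsτ, hs⟩ := exists_annihilating_effect hT hbit hαn haα horth hτn haτ Finset.univ
    exact hmax ⟨τ, hdist.option hT hbit hτn hsτ fun i => hs i (Finset.mem_univ i)⟩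
  have hχα : ∀ e, T.pair e χ = ∑ i, p * T.pair e (α i) := fun e => by
    rw [hν, eq_of_discard_eq_zero hT hν0, add_zero]
  refine ⟨horth, fun ρ => ?_, χ, p, hχ, hint, hp0, hχα⟩
  -- the daggers add up to the deterministic effect on the invariant state, which is internal
  obtain ⟨l, hl0, hl⟩ := hint
  obtain ⟨σ, hσn, hσ⟩ := exists_normalized hT ρ
  obtain ⟨ν', hν'⟩ := hl σ ((isNormState_iff hT σ).2 hσn)
  have h1 : ∑ i, T.pair (a i) χ = T.pair (discard hT A) χ := by
    rw [hχα]
    exact Finset.sum_congr rfl fun i _ => by rw [hp _ _ (ha i) (haα i), hαn, mul_one]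
  simp only [hν', Finset.sum_add_distrib, ← Finset.mul_sum] at h1
  have h2 := hsum_le ν'
  have h3 := hsum_le σ
  have h4 : ∑ i, T.pair (a i) σ = T.pair (discard hT A) σ := by
    refine le_antisymm h3 (le_of_mul_le_mul_left ?_ hl0)
    linarith
  simp only [hσ (a _), ← Finset.mul_sum, h4]
  rw [hσn, mul_one]

/-- The dagger of a normalised pure state is given by a pure effect. -/
theorem exists_dagger_eq {A : Sys} {α : 𝟙_ Sys ⟶ A} (hα : T.IsPure α) (hαn : T.IsNormState α)
    (hT : T.IsSharpWithPurification) : ∃ a : A ⟶ 𝟙_ Sys, T.IsPure a ∧ T.pair a α = 1 ∧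
      ∀ ρ, T.dagger α ρ = T.pair a ρ := by
  have h : ∃ a : A ⟶ 𝟙_ Sys, T.IsNormEffect a ∧ T.IsPure a ∧ T.pair a α = 1 := by
    obtain ⟨a, ha, haα⟩ := exists_dagger hT hα ((isNormState_iff hT α).1 hαn)
    exact ⟨a, isNormEffect_of_pair_eq_one haα hT, ha, haα⟩
  refine ⟨h.choose, h.choose_spec.2.1, h.choose_spec.2.2, fun ρ => ?_⟩
  rw [dagger, dif_pos h]

/-! ### Projectors and their transposes -/

/-- `P` fixes the states orthogonal to the `a i` with `i ∉ I`, and annihilates the states orthogonal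
to the `a i` with `i ∈ I`.  For the daggers `a i` of a pure maximal set this says that `P` is an
orthogonal projector on the face `F_I`, without reference to normalisation. -/
def ActsAsProjector (T : OPT Sys) {A : Sys} {ι : Type*} (a : ι → (A ⟶ 𝟙_ Sys)) (I : Finset ι)
    (P : A ⟶ A) : Prop :=
  (∀ ρ : 𝟙_ Sys ⟶ A, (∀ i, i ∉ I → T.pair (a i) ρ = 0) → ρ ≫ P = ρ) ∧
  ∀ ρ : 𝟙_ Sys ⟶ A, (∀ i ∈ I, T.pair (a i) ρ = 0) → ∀ e, T.pair e (ρ ≫ P) = 0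

theorem IsProjector.actsAsProjector (hT : T.IsSharpWithPurification) {A : Sys} {d : ℕ}
    {α : Fin d → (𝟙_ Sys ⟶ A)} {a : Fin d → (A ⟶ 𝟙_ Sys)}
    (hdag : ∀ i ρ, T.dagger (α i) ρ = T.pair (a i) ρ)
    (hsum : ∀ ρ, ∑ i, T.pair (a i) ρ = T.pair (discard hT A) ρ) {I : Finset (Fin d)} {P : A ⟶ A}
    (hP : T.IsProjector α I P) : T.ActsAsProjector a I P := by
  have hface : ∀ ρ, T.faceEffect α I ρ = ∑ i ∈ I, T.pair (a i) ρ := fun ρ => by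
    simp [faceEffect, hdag]
  have hzero : ∀ ρ : 𝟙_ Sys ⟶ A, T.pair (discard hT A) ρ = 0 → ∀ e, T.pair e (ρ ≫ P) = 0 :=
    fun ρ hρ e => by rw [pair_comp, eq_of_discard_eq_zero hT hρ]
  constructor
  · intro ρ hρ
    obtain ⟨σ, hσn, hσ⟩ := exists_normalized hT ρ
    apply T.state_ext
    intro e
    rcases eq_or_ne (T.pair (discard hT A) ρ) 0 with h0 | h0
    · rw [hzero ρ h0, eq_of_discard_eq_zero hT h0]
    · rw [pair_comp, hσ, ← pair_comp, hP.1 σ ⟨(isNormState_iff hT σ).2 hσn, ?_⟩, ← hσ]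
      rw [hface, ← hσn, ← hsum]
      refine Finset.sum_subset (Finset.subset_univ I) fun i _ hi => ?_
      have h1 := hρ i hi
      rw [hσ] at h1
      exact (mul_eq_zero.1 h1).resolve_left h0
  · intro ρ hρ e
    obtain ⟨σ, hσn, hσ⟩ := exists_normalized hT ρ
    rcases eq_or_ne (T.pair (discard hT A) ρ) 0 with h0 | h0
    · exact hzero ρ h0 e
    · have h1 := congrFun (hP.2 σ ⟨(isNormState_iff hT σ).2 hσn, by
        rw [hface]
        refine Finset.sum_eq_zero fun i hi => ?_
        have h1 := hρ i hi
        rw [hσ] at h1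
        exact (mul_eq_zero.1 h1).resolve_left h0⟩) e
      have h2 : T.pair e (σ ≫ P) = 0 := h1
      rw [pair_comp, hσ, ← pair_comp, h2, mul_zero]

/-- `Q` is a transpose on `B`, with respect to the state `Φ` of `A ⊗ B`, of a projector on the face
of `A` spanned by the `α i` with `i ∈ I`. -/
def IsDualProjector (T : OPT Sys) {A B : Sys} (Φ : 𝟙_ Sys ⟶ A ⊗ B) {ι : Type*}
    (α : ι → (𝟙_ Sys ⟶ A)) (I : Finset ι) (Q : B ⟶ B) : Prop :=
  (∀ e : A ⟶ 𝟙_ Sys, (∀ i, i ∉ I → T.pair e (α i) = 0) → condL e Φ ≫ Q = condL e Φ) ∧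
  ∀ e : A ⟶ 𝟙_ Sys, (∀ i ∈ I, T.pair e (α i) = 0) → ∀ f, T.pair f (condL e Φ ≫ Q) = 0

/-- A dual projector is a gentle measurement of the effect on `B` that steers the purification of
the invariant state to the part of that state belonging to `I`. -/
theorem exists_isDualProjector (hbit : T.HasBit) {A B : Sys} {Φ : 𝟙_ Sys ⟶ A ⊗ B}
    (hΦ : T.IsPure Φ) (hn : T.pair (discard hT (A ⊗ B)) Φ = 1) {ι : Type*} [Fintype ι]
    {α : ι → (𝟙_ Sys ⟶ A)} {p : ℝ} (hp0 : 0 < p)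
    (hχ : ∀ e, T.pair e (condR (discard hT B) Φ) = ∑ i, p * T.pair e (α i)) (I : Finset ι) :
    ∃ Q : B ⟶ B, T.IsDualProjector Φ α I Q := by
  classical
  have h1 := hχ (discard hT A)
  rw [pair_discard_condR, hn, ← Finset.sum_add_sum_compl I] at h1
  have hnonneg : ∀ s : Finset ι, 0 ≤ ∑ i ∈ s, p * T.pair (discard hT A) (α i) := fun s =>
    Finset.sum_nonneg fun i _ => mul_nonneg hp0.le (T.pair_nonneg _ _)
  obtain ⟨ρ₁, hρ₁⟩ := exists_finset_sum hT I (fun _ => p) α (fun _ _ => hp0.le) (by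
    linarith [hnonneg Iᶜ])
  obtain ⟨ρ₂, hρ₂⟩ := exists_finset_sum hT Iᶜ (fun _ => p) α (fun _ _ => hp0.le) (by
    linarith [hnonneg I])
  obtain ⟨E, K, -, hK⟩ := exists_steering hT hbit hΦ hn (ρ₁ := ρ₁) (ρ₂ := ρ₂) (fun e => by
    rw [hχ, hρ₁, hρ₂, Finset.sum_add_sum_compl])
  obtain ⟨Q, -, hQle, hQfix⟩ := exists_gentle hT hbit (K ≫ discard hT E)
  have hpair : ∀ e, T.pair (K ≫ discard hT E) (condL e Φ) = ∑ i ∈ I, p * T.pair e (α i) :=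
    fun e => by rw [← pair_condR_eq, hK, hρ₁]
  refine ⟨Q, fun e he => hQfix _ ?_, fun e he f => ?_⟩
  · rw [hpair, ← pair_condR_eq, hχ]
    exact Finset.sum_subset (Finset.subset_univ I) fun i _ hi => by rw [he i hi, mul_zero]
  · refine eq_of_discard_eq_zero hT (le_antisymm ((hQle _).trans ?_) (T.pair_nonneg _ _)) f
    rw [hpair, Finset.sum_eq_zero fun i hi => by rw [he i hi, mul_zero]]

/-- A projector is transposed by the dual projector. -/
theorem ActsAsProjector.condR_comp {A B : Sys} {Φ : 𝟙_ Sys ⟶ A ⊗ B} {ι : Type*}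
    {α : ι → (𝟙_ Sys ⟶ A)} {a : ι → (A ⟶ 𝟙_ Sys)}
    (horth : ∀ i j, i ≠ j → T.pair (a i) (α j) = 0) {I : Finset ι} {P : A ⟶ A} {Q : B ⟶ B}
    (hP : T.ActsAsProjector a I P) (hQ : T.IsDualProjector Φ α I Q) (f : B ⟶ 𝟙_ Sys) :
    condR f Φ ≫ P = condR (Q ≫ f) Φ := by
  have hfix : condR (Q ≫ f) Φ ≫ P = condR (Q ≫ f) Φ := by
    refine hP.1 _ fun i hi => ?_
    rw [pair_condR_eq, ← pair_comp]
    exact hQ.2 (a i) (fun j hj => horth i j (by rintro rfl; exact hi hj)) f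
  apply T.state_ext
  intro e
  have hPe : condL (P ≫ e) Φ ≫ Q = condL (P ≫ e) Φ := by
    refine hQ.1 _ fun i hi => ?_
    rw [← pair_comp]
    exact hP.2 (α i) (fun j hj => horth j i (by rintro rfl; exact hi hj)) e
  rw [pair_comp, pair_condR_eq, ← hPe, pair_comp, ← pair_condR_eq, ← pair_comp, hfix]

section Resolution

variable (hbit : T.HasBit) {A B : Sys} {Φ : 𝟙_ Sys ⟶ A ⊗ B} (hΦ : T.IsPure Φ)
  (hn : T.pair (discard hT (A ⊗ B)) Φ = 1) (hint : T.IsInternal (condR (discard hT B) Φ))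
  {ι : Type*} [Fintype ι] {α : ι → (𝟙_ Sys ⟶ A)} {p : ℝ} (hp0 : 0 < p)
  (hχ : ∀ e, T.pair e (condR (discard hT B) Φ) = ∑ i, p * T.pair e (α i))
  {a : ι → (A ⟶ 𝟙_ Sys)} (horth : ∀ i j, i ≠ j → T.pair (a i) (α j) = 0)
include hbit hΦ hn hint hp0 hχ horth

/-- All projectors on the same face agree on single systems. -/
theorem ActsAsProjector.eqOnSingle {I : Finset ι} {P P' : A ⟶ A} (hP : T.ActsAsProjector a I P)
    (hP' : T.ActsAsProjector a I P') : T.EqOnSingle P P' := by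
  obtain ⟨Q, hQ⟩ := exists_isDualProjector hT hbit hΦ hn hp0 hχ I
  obtain ⟨l, hl0, hl⟩ := hint
  intro ρ
  obtain ⟨σ, hσn, hσ⟩ := exists_normalized hT ρ
  have hσn' := (isNormState_iff hT σ).2 hσn
  obtain ⟨f, hf⟩ := exists_steering_effect hT hbit hΦ hn hσn' hl0.le (hl σ hσn')
  apply T.state_ext
  intro e
  have h1 : l * T.pair e (σ ≫ P) = l * T.pair e (σ ≫ P') := by
    rw [pair_comp, pair_comp, ← hf, ← hf, ← pair_comp, ← pair_comp, hP.condR_comp horth hQ,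
      hP'.condR_comp horth hQ]
  rw [pair_comp, hσ, pair_comp, hσ (P' ≫ e), ← pair_comp, ← pair_comp,
    mul_left_cancel₀ hl0.ne' h1]

theorem ActsAsProjector.pair_of_mem {J : Finset ι} {P : A ⟶ A} (hP : T.ActsAsProjector a J P)
    {i : ι} (hi : i ∈ J) (ρ : 𝟙_ Sys ⟶ A) : T.pair (a i) (ρ ≫ P) = T.pair (a i) ρ := by
  obtain ⟨Q, hQ⟩ := exists_isDualProjector hT hbit hΦ hn hp0 hχ J
  have h1 : P ≫ a i = a i := by
    refine effect_ext_of_condL hT hbit hΦ hn hint (T.state_ext fun f => ?_)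
    rw [← pair_condR_eq, ← pair_comp, hP.condR_comp horth hQ, pair_condR_eq, ← pair_comp,
      hQ.1 (a i) fun j hj => horth i j (by rintro rfl; exact hj hi)]
  rw [pair_comp, h1]

omit hbit hΦ hn hp0 in
theorem ActsAsProjector.pair_of_notMem {J : Finset ι} {P : A ⟶ A} (hP : T.ActsAsProjector a J P)
    {i : ι} (hi : i ∉ J) (ρ : 𝟙_ Sys ⟶ A) : T.pair (a i) (ρ ≫ P) = 0 := by
  have h1 : T.pair (P ≫ a i) (condR (discard hT B) Φ) = 0 := by
    rw [hχ]
    refine Finset.sum_eq_zero fun j _ => ?_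
    rw [← pair_comp]
    by_cases hj : j ∈ J
    · rw [hP.1 (α j) fun k hk => horth k j (by rintro rfl; exact hk hj),
        horth i j (by rintro rfl; exact hi hj), mul_zero]
    · rw [hP.2 (α j) (fun k hk => horth k j (by rintro rfl; exact hj hk)), mul_zero]
  obtain ⟨l, hl0, hl⟩ := hint
  obtain ⟨σ, hσn, hσ⟩ := exists_normalized hT ρ
  have h2 := (hl σ ((isNormState_iff hT σ).2 hσn)).le (P ≫ a i)
  rw [h1] at h2
  have h3 : T.pair (P ≫ a i) σ = 0 := by nlinarith [T.pair_nonneg (P ≫ a i) σ]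
  rw [pair_comp, hσ, h3, mul_zero]

/-- The composition of two projectors is a projector on the intersection of their faces. -/
theorem ActsAsProjector.comp [DecidableEq ι] {I J : Finset ι} {P P' : A ⟶ A}
    (hP : T.ActsAsProjector a I P) (hP' : T.ActsAsProjector a J P') :
    T.ActsAsProjector a (I ∩ J) (P' ≫ P) := by
  constructor
  · intro ρ hρ
    rw [← Category.assoc, hP'.1 ρ fun i hi => hρ i fun h => hi (Finset.mem_inter.1 h).2,
      hP.1 ρ fun i hi => hρ i fun h => hi (Finset.mem_inter.1 h).1]
  · intro ρ hρ e
    rw [← Category.assoc]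
    refine hP.2 _ (fun i hi => ?_) e
    by_cases hj : i ∈ J
    · rw [hP'.pair_of_mem hT hbit hΦ hn hint hp0 hχ horth hj, hρ i (Finset.mem_inter.2 ⟨hi, hj⟩)]
    · exact hP'.pair_of_notMem hT hint hχ horth hj ρ

end Resolution

/-! ### Systems with a single normalised state -/

theorem IsPureMaximal.subsingleton {A : Sys}
    (huniq : ∀ ρ σ : 𝟙_ Sys ⟶ A, T.IsNormState ρ → T.IsNormState σ → ρ = σ) {d : ℕ}
    {α : Fin d → (𝟙_ Sys ⟶ A)} (hα : T.IsPureMaximal α) : Subsingleton (Fin d) := by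
  obtain ⟨b, -, hb1, hb0⟩ := hα.2.1
  refine ⟨fun i j => ?_⟩
  by_contra hij
  have h1 := hb0 i j hij
  rw [← huniq _ _ (hα.1 i).1 (hα.1 j).1, hb1] at h1
  exact one_ne_zero h1

/-- On a system with a single normalised state, a projector is the identity or zero. -/
theorem IsProjector.of_subsingleton {A : Sys} (hT : T.IsSharpWithPurification)
    (huniq : ∀ ρ σ : 𝟙_ Sys ⟶ A, T.IsNormState ρ → T.IsNormState σ → ρ = σ) {d : ℕ}
    {α : Fin d → (𝟙_ Sys ⟶ A)} (hα : T.IsPureMaximal α) {I : Finset (Fin d)} {P : A ⟶ A}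
    (hP : T.IsProjector α I P) :
    (I.Nonempty → ∀ ρ : 𝟙_ Sys ⟶ A, ρ ≫ P = ρ) ∧ (I = ∅ → T.ZeroOnSingle P) := by
  constructor
  · rintro ⟨i, hi⟩ ρ
    obtain ⟨a, -, haα, hdag⟩ := exists_dagger_eq (hα.1 i).2 (hα.1 i).1 hT
    have hsub := hα.subsingleton huniq
    have hI : I = {i} :=
      Finset.eq_singleton_iff_unique_mem.2 ⟨hi, fun j _ => Subsingleton.elim j i⟩
    have hfix : α i ≫ P = α i := hP.1 _ ⟨(hα.1 i).1, by simp [faceEffect, hI, hdag, haα]⟩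
    obtain ⟨σ, hσn, hσ⟩ := exists_normalized hT ρ
    rw [huniq σ (α i) ((isNormState_iff hT σ).2 hσn) (hα.1 i).1] at hσ
    exact T.state_ext fun e => by rw [pair_comp, hσ, ← pair_comp, hfix, ← hσ]
  · rintro rfl ρ
    obtain ⟨σ, hσn, hσ⟩ := exists_normalized hT ρ
    have h1 := hP.2 σ ⟨(isNormState_iff hT σ).2 hσn, by simp [faceEffect]⟩
    funext e
    have h2 : T.pair e (σ ≫ P) = 0 := congrFun h1 e
    change T.pair e (ρ ≫ P) = 0
    rw [pair_comp, hσ, ← pair_comp, h2, mul_zero]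

theorem ZeroOnSingle.comp {A B C : Sys} {f : A ⟶ B} {g : B ⟶ C} (hf : T.ZeroOnSingle f) :
    T.ZeroOnSingle (f ≫ g) := by
  intro ρ
  funext e
  change T.pair e (ρ ≫ f ≫ g) = 0
  rw [← Category.assoc, pair_comp]
  exact congrFun (hf ρ) (g ≫ e)

theorem ZeroOnSingle.eqOnSingle {A B : Sys} {f g : A ⟶ B} (hf : T.ZeroOnSingle f)
    (hg : T.ZeroOnSingle g) : T.EqOnSingle f g :=
  fun ρ => T.stVec_injective ((hf ρ).trans (hg ρ).symm)

end OPT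

open OPT

theorem mainTheorem6 {Sys : Type u} [Category.{v} Sys] [MonoidalCategory Sys]
    [SymmetricCategory Sys] (T : OPT Sys) (hT : T.IsSharpWithPurification)
    {A : Sys} {d : ℕ} (α : Fin d → (𝟙_ Sys ⟶ A)) (hα : T.IsPureMaximal α)
    (I J : Finset (Fin d)) :
    (∀ P_I P_J P_IJ : A ⟶ A, T.IsProjector α I P_I → T.IsProjector α J P_J →
      T.IsProjector α (I ∩ J) P_IJ → T.EqOnSingle (P_J ≫ P_I) P_IJ) ∧
    (∀ P_I : A ⟶ A, T.IsProjector α I P_I → T.EqOnSingle (P_I ≫ P_I) P_I) ∧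
    (∀ P_I P_J : A ⟶ A, T.IsProjector α I P_I → T.IsProjector α J P_J →
      Disjoint I J → T.ZeroOnSingle (P_J ≫ P_I)) := by
  by_cases huniq : ∀ ρ σ : 𝟙_ Sys ⟶ A, T.IsNormState ρ → T.IsNormState σ → ρ = σ
  · -- the system has a single normalised state: a projector is the identity or zero
    have hid : ∀ {K : Finset (Fin d)} {P : A ⟶ A}, T.IsProjector α K P → K.Nonempty →
        ∀ ρ : 𝟙_ Sys ⟶ A, ρ ≫ P = ρ := fun h => (h.of_subsingleton hT huniq hα).1
    have hzero : ∀ {K : Finset (Fin d)} {P : A ⟶ A}, T.IsProjector α K P → K = ∅ →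
        T.ZeroOnSingle P := fun h => (h.of_subsingleton hT huniq hα).2
    have hsub := hα.subsingleton huniq
    have hcomp : ∀ P_I P_J : A ⟶ A, T.IsProjector α I P_I → T.IsProjector α J P_J →
        I ∩ J = ∅ → T.ZeroOnSingle (P_J ≫ P_I) := by
      intro P_I P_J hI hJ hIJ
      rcases J.eq_empty_or_nonempty with hJe | ⟨j, hj⟩
      · exact (hzero hJ hJe).comp
      · have hIe : I = ∅ := Finset.eq_empty_of_forall_notMem fun i hi => by
          have : i ∈ I ∩ J := Finset.mem_inter.2 ⟨hi, Subsingleton.elim j i ▸ hj⟩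
          simp [hIJ] at this
        intro ρ
        rw [← Category.assoc, hid hJ ⟨j, hj⟩]
        exact hzero hI hIe ρ
    refine ⟨fun P_I P_J P_IJ hI hJ hIJ => ?_, fun P_I hI ρ => ?_, fun P_I P_J hI hJ hd =>
      hcomp P_I P_J hI hJ (Finset.disjoint_iff_inter_eq_empty.1 hd)⟩
    · rcases (I ∩ J).eq_empty_or_nonempty with he | hne
      · exact (hcomp P_I P_J hI hJ he).eqOnSingle (hzero hIJ he)
      · intro ρ
        rw [← Category.assoc, hid hJ (hne.mono Finset.inter_subset_right),
          hid hI (hne.mono Finset.inter_subset_left), hid hIJ hne]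
    · rw [← Category.assoc]
      rcases I.eq_empty_or_nonempty with he | hne
      · apply T.stVec_injective
        rw [hzero hI he ρ]
        exact hzero hI he (ρ ≫ P_I)
      · rw [hid hI hne, hid hI hne]
  push Not at huniq
  obtain ⟨ρ₀, σ₀, hρ₀, hσ₀, hne⟩ := huniq
  have hbit : T.HasBit := by
    obtain ⟨x, ξ₀, ξ₁, h1, h2, h3, h4, h5⟩ := exists_distinguishable hT hρ₀ hσ₀ hne
    exact ⟨A, x, ξ₀, ξ₁, h1, h2, h3, (isNormState_iff hT _).2 h4, (isNormState_iff hT _).2 h5⟩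
  choose a ha haα hdag using fun i => exists_dagger_eq (hα.1 i).2 (hα.1 i).1 hT
  obtain ⟨horth, hsum, χ, p, hχn, hint, hp0, hχ⟩ := hα.resolution hT hbit ha haα
  obtain ⟨B, Φ, hn, hΦ, rfl⟩ := exists_purification hT ((isNormState_iff hT χ).1 hχn)
  have hact : ∀ {K : Finset (Fin d)} {P : A ⟶ A}, T.IsProjector α K P →
      T.ActsAsProjector a K P := fun h => h.actsAsProjector hT hdag hsum
  have hcomp : ∀ {K L : Finset (Fin d)} {P P' : A ⟶ A}, T.IsProjector α K P →
      T.IsProjector α L P' → T.ActsAsProjector a (K ∩ L) (P' ≫ P) := fun h h' =>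
    (hact h).comp hT hbit hΦ hn hint hp0 hχ horth (hact h')
  have heq : ∀ {K : Finset (Fin d)} {P P' : A ⟶ A}, T.ActsAsProjector a K P →
      T.ActsAsProjector a K P' → T.EqOnSingle P P' := fun h h' =>
    h.eqOnSingle hT hbit hΦ hn hint hp0 hχ horth h'
  refine ⟨fun P_I P_J P_IJ hI hJ hIJ => heq (hcomp hI hJ) (hact hIJ), fun P_I hI => ?_,
    fun P_I P_J hI hJ hd ρ => funext fun e => ?_⟩
  · have h := hcomp hI hI
    rw [Finset.inter_self] at h
    exact heq h (hact hI)
  · have h := hcomp hI hJ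
    rw [Finset.disjoint_iff_inter_eq_empty.1 hd] at h
    exact h.2 ρ (by simp) e
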